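/- Let $K\subseteq\mathbb R$ be a field (for instance $K=\mathbb Q$), and let $\mathbf r(t)=(x(t),y(t),z(t))$ with $x,y,z\in K(t)$ be a rational space curve that is properly parametrized, i.e. $K(x,y,z)=K(t)$, whose coordinate functions have no poles in $[0,1]$, and such that $\{\mathbf r(t):t\in[0,1]\}$ is not contained in a plane. Write $\boldsymbol\alpha=\mathbf r'/\|\mathbf r'\|$ and $\boldsymbol\gamma=(\mathbf r'\times\mathbf r'')/\|\mathbf r'\times\mathbf r''\|$ for the unit tangent and binormal, and $\kappa=\|\mathbf r'\times\mathbf r''\|/\|\mathbf r'\|^3$, $\tau=\det(\mathbf r',\mathbf r'',\mathbf r''')/\|\mathbf r'\times\mathbf r''\|^2$ for the curvature and torsion. The right (left) tangent line at $t$ is the line through $\mathbf r(t)$ with direction the right (left) limit of $\boldsymbol\alpha$ at $t$; the right (left) osculating plane at $t$ is the plane through $\mathbf r(t)$ whose normal is the right (left) limit of $\boldsymbol\gamma$ at $t$; the osculating plane $O(t)$ at a parameter with $\kappa(t)\neq0$ is the plane through $\mathbf r(t)$ with normal $\boldsymbol\gamma(t)$. A point $\mathbf r(t)$ is singular if $\mathbf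 r'(t)=0$ or $\mathbf r(s)=\mathbf r(t)$ for some real $s\ne t$ at which $\mathbf r$ is defined; $t$ is a character parameter if $\mathbf r(t)$ is singular or $\kappa(t)=0$ or $\tau(t)=0$. For $a<b$, the associated tetrahedron of the segment $\mathbf r|_{[a,b]}$ is the nondegenerate tetrahedron $\mathbf r_0\mathbf r_1\mathbf r_2\mathbf r_3$ with $\mathbf r_0=\mathbf r(a)$, $\mathbf r_3=\mathbf r(b)$, where the right osculating plane at $a$ and the left osculating plane at $b$ are not parallel and their line of intersection meets the right tangent line at $a$ exactly in $\mathbf r_1$ and the left tangent line at $b$ exactly in $\mathbf r_2$ (it need not exist, but is unique if it does). Theorem. For every $t_0\in[0,1)$ there is $t_1\in(t_0,1]$ such that $\mathbf r(t)$, $t\in[t_0,t_1]$, is a quasi-cubic Bézier segment, i.e. its associated tetrahedron $\mathbf r_0\mathbf r_1\mathbf r_2\mathbf r_3$ exists and the following eight properties hold. 1. The segment has endpoints $\mathbf r_0,\mathbf r_3$; the right tangent line at $t_0$ is the line $\mathbf r_0\mathbf r_1$ and the left tangent line at $t_1$ is the line $\mathbf r_2\mathbf r_3$. 2. The right osculating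 plane at $t_0$ is the plane $\mathbf r_0\mathbf r_1\mathbf r_2$ and the left osculating plane at $t_1$ is the plane $\mathbf r_1\mathbf r_2\mathbf r_3$. 3. $\mathbf r(t)$ lies in the closed solid tetrahedron $\mathbf r_0\mathbf r_1\mathbf r_2\mathbf r_3$ for all $t\in[t_0,t_1]$. 4. $\mathbf r$ is injective on $[t_0,t_1]$, and no $t\in[t_0,t_1]$, except possibly $t=t_0$ (when $t_0$ itself is a character parameter of the given curve), is a character parameter: there are no singular points, and $\kappa\ne0$, $\tau\neq0$. 5. For all $t_0\le t_1^\star<t_2^\star\le t_1$ the associated tetrahedron of $\mathbf r|_{[t_1^\star,t_2^\star]}$ exists and is contained in the solid tetrahedron $\mathbf r_0\mathbf r_1\mathbf r_2\mathbf r_3$. 6. For $t^\star\in(t_0,t_1)$ the osculating plane $O(t^\star)$ meets each of the lines $\mathbf r_0\mathbf r_1$, $\mathbf r_1\mathbf r_2$, $\mathbf r_2\mathbf r_3$ in exactly one point, $\mathbf r_{01},\mathbf r_{12},\mathbf r_{23}$ respectively; these points lie strictly inside the corresponding edges, and $\|\mathbf r_0\mathbf r_{01}\|$, $\|\mathbf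 r_1\mathbf r_{12}\|$, $\|\mathbf r_2\mathbf r_{23}\|$ are strictly increasing functions of $t^\star\in(t_0,t_1)$. 7. For $t^\star\in(t_0,t_1)$ the plane $\mathbf r_1\mathbf r_2\mathbf r(t^\star)$ meets the line $\mathbf r_0\mathbf r_3$ in exactly one point $\mathbf r_{03}$ and the plane $\mathbf r_0\mathbf r_3\mathbf r(t^\star)$ meets the line $\mathbf r_1\mathbf r_2$ in exactly one point $\mathbf r_{12}$; these points lie strictly inside the corresponding edges, and $\|\mathbf r_0\mathbf r_{03}\|$, $\|\mathbf r_1\mathbf r_{12}\|$ are strictly increasing functions of $t^\star\in(t_0,t_1)$. 8. For each of the two planes $Q=\mathbf r_0\mathbf r_2\mathbf r_3$ and $Q=\mathbf r_0\mathbf r_1\mathbf r_3$ the segment has exactly one parallel point, and that point has the maximal distance to $Q$ among the points of the segment. Here the open segment $\mathbf r((t_0,t_1))$ lies strictly on one side of $Q$, its endpoints lie on $Q$, and a parallel point associated to $Q$ is a point $\mathbf r(t)$, $t\in[t_0,t_1]$, at which the curve is tangent to a plane parallel to and different from $Q$. -/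

import Mathlib

open Set Filter Topology

noncomputable section

/-- Euclidean three-space. -/
abbrev E3 : Type := EuclideanSpace ℝ (Fin 3)

/-- The cross product on Euclidean three-space. -/
def cross (u v : E3) : E3 := WithLp.toLp 2 (crossProduct u.ofLp v.ofLp)

namespace RatCurve

variable {K : Type*} [Field K] [Algebra K ℝ]

/-- The three coordinate functions `c 0, c 1, c 2` have no pole at the real parameter `t`. -/
def DefinedAt (c : Fin 3 → RatFunc K) (t : ℝ) : Prop :=
  ∀ i, Polynomial.aeval t (c i).denom ≠ 0

/-- The point of the rational space curve with coordinates `c` at the real parameter `t`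
(meaningful where `c` is defined). -/
def point (c : Fin 3 → RatFunc K) (t : ℝ) : E3 :=
  WithLp.toLp 2 fun i => Polynomial.aeval t (c i).num / Polynomial.aeval t (c i).denom

/-- The parametrization is proper (birational onto its image): the coordinate functions generate
the field of rational functions of the parameter. -/
def IsProper (c : Fin 3 → RatFunc K) : Prop :=
  IntermediateField.adjoin K (Set.range c) = ⊤

end RatCurve

/-- The curvature `‖r' × r''‖ / ‖r'‖³`. -/
def curvature (r : ℝ → E3) (t : ℝ) : ℝ :=
  ‖cross (deriv r t) (iteratedDeriv 2 r t)‖ / ‖deriv r t‖ ^ 3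

/-- The torsion `(r', r'', r''') / ‖r' × r''‖²`. -/
def torsion (r : ℝ → E3) (t : ℝ) : ℝ :=
  inner ℝ (cross (deriv r t) (iteratedDeriv 2 r t)) (iteratedDeriv 3 r t) /
    ‖cross (deriv r t) (iteratedDeriv 2 r t)‖ ^ 2

/-- The unit tangent vector `r' / ‖r'‖`. -/
def unitTangent (r : ℝ → E3) (t : ℝ) : E3 :=
  ‖deriv r t‖⁻¹ • deriv r t

/-- The unit binormal vector `(r' × r'') / ‖r' × r''‖`. -/
def binormal (r : ℝ → E3) (t : ℝ) : E3 :=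
  ‖cross (deriv r t) (iteratedDeriv 2 r t)‖⁻¹ • cross (deriv r t) (iteratedDeriv 2 r t)

/-- The line through `p` with direction vector `v`. -/
def lineThrough (p v : E3) : AffineSubspace ℝ E3 :=
  AffineSubspace.mk' p (Submodule.span ℝ {v})

/-- The plane through `p` with normal vector `n`. -/
def planeThrough (p n : E3) : AffineSubspace ℝ E3 :=
  AffineSubspace.mk' p (Submodule.span ℝ {n})ᗮ

/-- The osculating plane at a parameter where the curvature does not vanish. -/
def osculatingPlane (r : ℝ → E3) (t : ℝ) : AffineSubspace ℝ E3 :=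
  planeThrough (r t) (binormal r t)

/-- `T` is the right tangent line at `t`: its direction is the right limit of the unit tangent. -/
def IsRightTangentLine (r : ℝ → E3) (t : ℝ) (T : AffineSubspace ℝ E3) : Prop :=
  ∃ v, Tendsto (unitTangent r) (𝓝[>] t) (𝓝 v) ∧ T = lineThrough (r t) v

/-- `T` is the left tangent line at `t`. -/
def IsLeftTangentLine (r : ℝ → E3) (t : ℝ) (T : AffineSubspace ℝ E3) : Prop :=
  ∃ v, Tendsto (unitTangent r) (𝓝[<] t) (𝓝 v) ∧ T = lineThrough (r t) v

/-- `O` is the right osculating plane at `t`: its normal is the right limit of the binormal. -/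
def IsRightOsculatingPlane (r : ℝ → E3) (t : ℝ) (O : AffineSubspace ℝ E3) : Prop :=
  ∃ n, Tendsto (binormal r) (𝓝[>] t) (𝓝 n) ∧ O = planeThrough (r t) n

/-- `O` is the left osculating plane at `t`. -/
def IsLeftOsculatingPlane (r : ℝ → E3) (t : ℝ) (O : AffineSubspace ℝ E3) : Prop :=
  ∃ n, Tendsto (binormal r) (𝓝[<] t) (𝓝 n) ∧ O = planeThrough (r t) n

/-- `P 0, P 1, P 2, P 3` are the vertices of the associated (nondegenerate) tetrahedron of the
segment `r(t), t ∈ [a, b]`: `P 0` and `P 3` are the endpoints of the segment; the right osculating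
plane at `a` and the left osculating plane at `b` are not parallel, and their line of intersection
meets the right tangent line at `a` exactly in `P 1` and the left tangent line at `b` exactly
in `P 2`. -/
def IsAssociatedTetrahedron (r : ℝ → E3) (a b : ℝ) (P : Fin 4 → E3) : Prop :=
  P 0 = r a ∧ P 3 = r b ∧ AffineIndependent ℝ P ∧
  ∃ Ta Tb Oa Ob : AffineSubspace ℝ E3,
    IsRightTangentLine r a Ta ∧ IsLeftTangentLine r b Tb ∧
    IsRightOsculatingPlane r a Oa ∧ IsLeftOsculatingPlane r b Ob ∧
    ¬ Oa.Parallel Ob ∧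
    (Ta : Set E3) ∩ (Oa ∩ Ob) = {P 1} ∧
    (Tb : Set E3) ∩ (Oa ∩ Ob) = {P 2}

/-- The solid tetrahedron with vertices `P 0, P 1, P 2, P 3`. -/
def solidTetrahedron (P : Fin 4 → E3) : Set E3 := convexHull ℝ (Set.range P)

/-- `r(t)` is a singular point of the rational curve: a cusp, or a point that corresponds to more
than one parameter. -/
def RatCurve.IsSingularAt {K : Type*} [Field K] [Algebra K ℝ] (c : Fin 3 → RatFunc K)
    (t : ℝ) : Prop :=
  deriv (RatCurve.point c) t = 0 ∨
    ∃ s, s ≠ t ∧ RatCurve.DefinedAt c s ∧ RatCurve.point c s = RatCurve.point c t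

/-- `r(t)` is a character point of the rational curve: a singular point, an inflection, or a
torsion vanishing point. -/
def RatCurve.IsCharacterAt {K : Type*} [Field K] [Algebra K ℝ] (c : Fin 3 → RatFunc K)
    (t : ℝ) : Prop :=
  RatCurve.IsSingularAt c t ∨ curvature (RatCurve.point c) t = 0 ∨
    torsion (RatCurve.point c) t = 0

/-- For every `t ∈ (a, b)` the plane `F t` meets the line `AB` in exactly one point `q t`; this
point lies strictly between `A` and `B`, and its distance from `A` is strictly increasing
in `t`. -/
def MovesMonotonically (F : ℝ → AffineSubspace ℝ E3) (A B : E3) (a b : ℝ) : Prop :=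
  ∃ q : ℝ → E3,
    (∀ t ∈ Ioo a b,
      (F t : Set E3) ∩ (affineSpan ℝ {A, B} : AffineSubspace ℝ E3) = {q t} ∧
        q t ∈ openSegment ℝ A B) ∧
    StrictMonoOn (fun t => dist A (q t)) (Ioo a b)

/-- `r(t)` is a parallel point, associated to the plane `Q`, of the segment `r` on `[a, b]`:
the segment lies on one side of `Q`, its two endpoints lie on `Q`, and the curve is tangent at
`r(t)` to a plane `R` that is parallel to and different from `Q`. -/
def IsParallelPoint (r : ℝ → E3) (a b : ℝ) (Q : AffineSubspace ℝ E3) (t : ℝ) : Prop :=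
  (r a ∈ Q ∧ r b ∈ Q ∧ ∀ s ∈ Ioo a b, ∀ s' ∈ Ioo a b, Q.SSameSide (r s) (r s')) ∧
  t ∈ Icc a b ∧
  ∃ R : AffineSubspace ℝ E3, R.Parallel Q ∧ R ≠ Q ∧ r t ∈ R ∧ deriv r t ∈ R.direction

/-- The segment has exactly one parallel point associated to `Q`, and that point has the maximal
distance to `Q` among the points of the segment. -/
def HasUniqueParallelPoint (r : ℝ → E3) (a b : ℝ) (Q : AffineSubspace ℝ E3) : Prop :=
  ∃ t, IsParallelPoint r a b Q t ∧ (∀ s, IsParallelPoint r a b Q s → s = t) ∧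
    ∀ s ∈ Icc a b, Metric.infDist (r s) (Q : Set E3) ≤ Metric.infDist (r t) (Q : Set E3)

/-- The eight properties of a non-planar rational cubic Bézier segment with respect to its control
tetrahedron, for the segment of the rational curve `c` on `[a, b]` and the tetrahedron `P`.
At the start parameter `a`, which may be a character point of the given curve, tangent and
osculating plane are right limits, and the absence of character points is required at all other
parameters of `[a, b]` (so on all of `[a, b]` when `a` is not a character point). -/
structure HasCubicProperties {K : Type*} [Field K] [Algebra K ℝ] (c : Fin 3 → RatFunc K)
    (a b : ℝ) (P : Fin 4 → E3) : Prop where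
  endpoint_tangents :
    P 0 = RatCurve.point c a ∧ P 3 = RatCurve.point c b ∧
    IsRightTangentLine (RatCurve.point c) a (affineSpan ℝ {P 0, P 1}) ∧
    IsLeftTangentLine (RatCurve.point c) b (affineSpan ℝ {P 2, P 3})
  endpoint_osculating_planes :
    IsRightOsculatingPlane (RatCurve.point c) a (affineSpan ℝ {P 0, P 1, P 2}) ∧
    IsLeftOsculatingPlane (RatCurve.point c) b (affineSpan ℝ {P 1, P 2, P 3})
  inside : ∀ t ∈ Icc a b, RatCurve.point c t ∈ solidTetrahedron P
  no_character_points :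
    InjOn (RatCurve.point c) (Icc a b) ∧
    ∀ t ∈ Icc a b, RatCurve.IsCharacterAt c t → t = a
  sub_tetrahedra : ∀ a' b', a ≤ a' → a' < b' → b' ≤ b →
    ∃ P' : Fin 4 → E3, IsAssociatedTetrahedron (RatCurve.point c) a' b' P' ∧
      solidTetrahedron P' ⊆ solidTetrahedron P
  osculating_monotone :
    MovesMonotonically (osculatingPlane (RatCurve.point c)) (P 0) (P 1) a b ∧
    MovesMonotonically (osculatingPlane (RatCurve.point c)) (P 1) (P 2) a b ∧
    MovesMonotonically (osculatingPlane (RatCurve.point c)) (P 2) (P 3) a b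
  edge_monotone :
    MovesMonotonically (fun t => affineSpan ℝ {P 1, P 2, RatCurve.point c t}) (P 0) (P 3) a b ∧
    MovesMonotonically (fun t => affineSpan ℝ {P 0, P 3, RatCurve.point c t}) (P 1) (P 2) a b
  parallel_points :
    HasUniqueParallelPoint (RatCurve.point c) a b (affineSpan ℝ {P 0, P 2, P 3}) ∧
    HasUniqueParallelPoint (RatCurve.point c) a b (affineSpan ℝ {P 0, P 1, P 3})

/-- A quasi-cubic Bézier segment: the associated tetrahedron exists and the segment has the eight
properties with respect to it. -/
def IsQuasiCubic {K : Type*} [Field K] [Algebra K ℝ] (c : Fin 3 → RatFunc K)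
    (a b : ℝ) : Prop :=
  ∃ P : Fin 4 → E3, IsAssociatedTetrahedron (RatCurve.point c) a b P ∧ HasCubicProperties c a b P

end

/-!
To the right of `t₀`, the derivative of the curve can be written near `t₀` as `r' = x' B` with
`x' > 0` and an analytic vector function `B` which does not vanish at `t₀`; in the same way
`B' = m' E` and `E' = k' G` with `m', k' > 0`. This is obtained by splitting off powers of
`t - t₀` (`AnalyticAt.exists_eq_smul`), and it fails only if the curve is planar. In the basis
`B t₀`, `E t₀`, `G t₀` the curve becomes a triple `(x, y, z)` with `dy = m dx`, `dz = l dx`,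
`dl = k dm`, where `x`, `m`, `k` are increasing (`ChebyshevCurve`, `AnalyticAt.exists_represents`). The derivatives
`x'`, `m'`, `k'` may vanish at `t₀` itself, which is how cusps, inflections and torsion zeros at
the start of the segment are absorbed.

Everything else follows from the monotonicity of `x`, `m`, `k`. The class of these curves is stable
under three operations: affine coordinates can be adapted to the flag (point, tangent, osculating
plane) at any parameter (`pin`), the curve can be traversed backwards (`reverse`), and the curve of
osculating planes is again such a curve, with `x` and `k` interchanged (`dual`). In coordinates
pinned at `s` all the natural minors `x`, `y`, `z`, `g`, `h`, `w`, `j`, `q` are positive because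
their derivatives are products of previous ones, and quotients such as `z / y`, `l / m`, `j / g` and
`q / j` increase because their Wronskians are again such products (`ratio_lt`).

The face functions of the control tetrahedron (`face`) are expressed by these minors. Their
positivity places the curve inside the tetrahedron (`IsOn.face_curve_pos`). The quotient `q / j`
shows that cutting the segment at the right end shrinks the tetrahedron (`IsOn.face_left`), and
reversal gives the left end. The monotone motion of the osculating plane along the middle edge is
dual to that of the plane through the chord (`IsPinned.chord_planes_lt`). For each of the two planes
the parallel points are the critical points of a face function; there is only one since `l / m` is
injective (`IsPinned.face_two_critical`).

That no point after `t₀` is multiple follows from properness: the parameter is a rational function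
of the point, which excludes all but finitely many parameters (`RatCurve.finite_multiple_points`).
-/

noncomputable section

/-! ### Chebyshev curves -/

/-- The data of a curve `(x, y, z)` in `ℝ³` in canonical position: `m` and `l` are the slopes
`dy/dx` and `dz/dx`, `k` is the second slope `dl/dm`, and `dx`, `dm`, `dk` stand for the
derivatives of `x`, `m`, `k`. -/
structure ChebyshevCurve where
  (x y z m l k dx dm dk : ℝ → ℝ)

namespace ChebyshevCurve

variable (C : ChebyshevCurve)

/-- On `[a, b]` the curve is obtained by iterated integration from the increasing functions
`x`, `m`, `k`. Derivatives are only required in the open interval, so that `dx`, `dm`, `dk` may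
vanish or be undefined at the ends. -/
structure IsOn (a b : ℝ) : Prop where
  cx : ContinuousOn C.x (Icc a b)
  cy : ContinuousOn C.y (Icc a b)
  cz : ContinuousOn C.z (Icc a b)
  cm : ContinuousOn C.m (Icc a b)
  cl : ContinuousOn C.l (Icc a b)
  ck : ContinuousOn C.k (Icc a b)
  hx : ∀ t ∈ Ioo a b, HasDerivAt C.x (C.dx t) t
  hy : ∀ t ∈ Ioo a b, HasDerivAt C.y (C.m t * C.dx t) t
  hz : ∀ t ∈ Ioo a b, HasDerivAt C.z (C.l t * C.dx t) t
  hm : ∀ t ∈ Ioo a b, HasDerivAt C.m (C.dm t) t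
  hl : ∀ t ∈ Ioo a b, HasDerivAt C.l (C.k t * C.dm t) t
  hk : ∀ t ∈ Ioo a b, HasDerivAt C.k (C.dk t) t
  px : ∀ t ∈ Ioo a b, 0 < C.dx t
  pm : ∀ t ∈ Ioo a b, 0 < C.dm t
  pk : ∀ t ∈ Ioo a b, 0 < C.dk t

/-- A Chebyshev curve on `[s, e]` which at `s` passes through the origin with its standard flag. -/
structure IsPinned (s e : ℝ) : Prop extends C.IsOn s e where
  zx : C.x s = 0
  zy : C.y s = 0
  zz : C.z s = 0
  zm : C.m s = 0
  zl : C.l s = 0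
  zk : C.k s = 0

/-- The affine function which cuts out the tangent line at `s` inside the osculating plane
at `s`; it does not depend on the third coordinate. -/
def beta (s X Y : ℝ) : ℝ := Y - C.y s - C.m s * (X - C.x s)

/-- The affine function which vanishes on the osculating plane at `s`. -/
def phi (s X Y Z : ℝ) : ℝ :=
  Z - C.z s - C.k s * (Y - C.y s) + (C.m s * C.k s - C.l s) * (X - C.x s)

/-- The linear part of `phi s` at the tangent vector `(1, m t, l t)`. -/
def lam (s t : ℝ) : ℝ := C.l t - C.l s - C.k s * (C.m t - C.m s)

/-- `phi s` at the point of parameter `t`. -/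
def phiAt (s t : ℝ) : ℝ := C.phi s (C.x t) (C.y t) (C.z t)

/-- `beta s` at the point of parameter `t`. -/
def betaAt (s t : ℝ) : ℝ := C.beta s (C.x t) (C.y t)

/-- The curve in the affine coordinates adapted to its flag at `s`. -/
def pin (s : ℝ) : ChebyshevCurve where
  x t := C.x t - C.x s
  y t := C.betaAt s t
  z t := C.phiAt s t
  m t := C.m t - C.m s
  l t := C.lam s t
  k t := C.k t - C.k s
  dx := C.dx
  dm := C.dm
  dk := C.dk

/-- The coordinate `g` of the dual curve. -/
def g (t : ℝ) : ℝ := C.m t * C.x t - C.y t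

/-- The coordinate `h` of the dual curve: `(h, -k, 1)` is normal to the osculating plane. -/
def h (t : ℝ) : ℝ := C.m t * C.k t - C.l t

/-- The coordinate `w` of the dual curve: the osculating plane is `h X - k Y + Z = w`. -/
def w (t : ℝ) : ℝ := C.z t - C.k t * C.y t + C.h t * C.x t

/-- The Plücker coordinate `l x - z` of the tangent line. -/
def j (t : ℝ) : ℝ := C.l t * C.x t - C.z t

/-- The Plücker coordinate `l y - m z` of the tangent line. -/
def q (t : ℝ) : ℝ := C.l t * C.y t - C.m t * C.z t

/-- The curve of osculating planes, which is again a Chebyshev curve. -/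
def dual : ChebyshevCurve where
  x := C.k
  y := C.h
  z := C.w
  m := C.m
  l := C.g
  k := C.x
  dx := C.dk
  dm := C.dm
  dk := C.dx

/-- The curve traversed backwards, composed with `(X, Y, Z) ↦ (-X, Y, -Z)`. -/
def reverse : ChebyshevCurve where
  x t := -C.x (-t)
  y t := C.y (-t)
  z t := -C.z (-t)
  m t := -C.m (-t)
  l t := C.l (-t)
  k t := -C.k (-t)
  dx t := C.dx (-t)
  dm t := C.dm (-t)
  dk t := C.dk (-t)

variable {C}

theorem IsOn.mono {a b s e : ℝ} (H : C.IsOn a b) (hs : a ≤ s) (he : e ≤ b) : C.IsOn s e := by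
  have h1 : Icc s e ⊆ Icc a b := Icc_subset_Icc hs he
  have h2 : Ioo s e ⊆ Ioo a b := Ioo_subset_Ioo hs he
  exact ⟨H.cx.mono h1, H.cy.mono h1, H.cz.mono h1, H.cm.mono h1, H.cl.mono h1, H.ck.mono h1,
    fun t ht => H.hx t (h2 ht), fun t ht => H.hy t (h2 ht), fun t ht => H.hz t (h2 ht),
    fun t ht => H.hm t (h2 ht), fun t ht => H.hl t (h2 ht), fun t ht => H.hk t (h2 ht),
    fun t ht => H.px t (h2 ht), fun t ht => H.pm t (h2 ht), fun t ht => H.pk t (h2 ht)⟩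

theorem IsOn.pin_isOn {s e : ℝ} (H : C.IsOn s e) (c : ℝ) : (C.pin c).IsOn s e := by
  obtain ⟨cx, cy, cz, cm, cl, ck, hx, hy, hz, hm, hl, hk, px, pm, pk⟩ := H
  refine ⟨?_, ?_, ?_, ?_, ?_, ?_, fun t ht => ?_, fun t ht => ?_, fun t ht => ?_, fun t ht => ?_,
    fun t ht => ?_, fun t ht => ?_, px, pm, pk⟩ <;>
    simp only [pin, betaAt, phiAt, beta, phi, lam]
  · fun_prop
  · fun_prop
  · fun_prop
  · fun_prop
  · fun_prop
  · fun_prop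
  · exact (hx t ht).sub_const _
  · refine HasDerivAt.congr_deriv
      (((hy t ht).sub_const _).sub (((hx t ht).sub_const _).const_mul (C.m c))) ?_
    ring
  · refine HasDerivAt.congr_deriv
      ((((hz t ht).sub_const _).sub (((hy t ht).sub_const _).const_mul (C.k c))).add
      (((hx t ht).sub_const _).const_mul (C.m c * C.k c - C.l c))) ?_
    ring
  · exact (hm t ht).sub_const _
  · refine HasDerivAt.congr_deriv
      (((hl t ht).sub_const _).sub (((hm t ht).sub_const _).const_mul (C.k c))) ?_
    ring
  · exact (hk t ht).sub_const _

theorem IsOn.pin {a b s e : ℝ} (H : C.IsOn a b) (hs : a ≤ s) (he : e ≤ b) :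
    (C.pin s).IsPinned s e where
  toIsOn := (H.mono hs he).pin_isOn s
  zx := by simp [ChebyshevCurve.pin]
  zy := by simp [ChebyshevCurve.pin, betaAt, beta]
  zz := by simp [ChebyshevCurve.pin, phiAt, phi]
  zm := by simp [ChebyshevCurve.pin]
  zl := by simp [ChebyshevCurve.pin, lam]
  zk := by simp [ChebyshevCurve.pin]

theorem IsOn.reverse {a b : ℝ} (H : C.IsOn a b) : C.reverse.IsOn (-b) (-a) := by
  obtain ⟨cx, cy, cz, cm, cl, ck, hx, hy, hz, hm, hl, hk, px, pm, pk⟩ := H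
  have h1 : MapsTo (fun t : ℝ => -t) (Icc (-b) (-a)) (Icc a b) :=
    fun t ht => ⟨by linarith [ht.2], by linarith [ht.1]⟩
  have h2 : ∀ t ∈ Ioo (-b) (-a), -t ∈ Ioo a b :=
    fun t ht => ⟨by linarith [ht.2], by linarith [ht.1]⟩
  have hc : ContinuousOn (fun t : ℝ => -t) (Icc (-b) (-a)) := continuous_neg.continuousOn
  have hd : ∀ {f : ℝ → ℝ} {f' t : ℝ}, HasDerivAt f f' (-t) →
      HasDerivAt (fun t => f (-t)) (-f') t := fun {f f' t} hf => by
    exact (hf.comp t (hasDerivAt_neg t)).congr_deriv (by ring)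
  refine ⟨(cx.comp hc h1).neg, cy.comp hc h1, (cz.comp hc h1).neg, (cm.comp hc h1).neg,
    cl.comp hc h1, (ck.comp hc h1).neg, fun t ht => ?_, fun t ht => ?_, fun t ht => ?_,
    fun t ht => ?_, fun t ht => ?_, fun t ht => ?_, fun t ht => px _ (h2 t ht),
    fun t ht => pm _ (h2 t ht), fun t ht => pk _ (h2 t ht)⟩ <;> simp only [ChebyshevCurve.reverse]
  · exact (hd (hx _ (h2 t ht))).neg.congr_deriv (by ring)
  · exact (hd (hy _ (h2 t ht))).congr_deriv (by ring)
  · exact (hd (hz _ (h2 t ht))).neg.congr_deriv (by ring)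
  · exact (hd (hm _ (h2 t ht))).neg.congr_deriv (by ring)
  · exact (hd (hl _ (h2 t ht))).congr_deriv (by ring)
  · exact (hd (hk _ (h2 t ht))).neg.congr_deriv (by ring)

/-! ### Positive minors and increasing quotients -/

/-- A function on `[s, e]` with vanishing initial value and positive derivative is positive. -/
theorem pos_of_deriv_pos {f f' : ℝ → ℝ} {s e : ℝ} (cf : ContinuousOn f (Icc s e))
    (hf : ∀ t ∈ Ioo s e, HasDerivAt f (f' t) t) (hp : ∀ t ∈ Ioo s e, 0 < f' t) (h0 : f s = 0) :
    ∀ t ∈ Ioc s e, 0 < f t := by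
  intro t ht
  have hmono : StrictMonoOn f (Icc s e) := by
    refine strictMonoOn_of_deriv_pos (convex_Icc s e) cf fun u hu => ?_
    rw [interior_Icc] at hu
    rw [(hf u hu).deriv]
    exact hp u hu
  have := hmono ⟨le_rfl, ht.1.le.trans ht.2⟩ ⟨ht.1.le, ht.2⟩ ht.1
  rwa [h0] at this

/-- A quotient `f / g` is increasing as soon as its Wronskian is positive. -/
theorem ratio_lt {f f' g g' : ℝ → ℝ} {t t' : ℝ} (htt : t < t') (cf : ContinuousOn f (Icc t t'))
    (cg : ContinuousOn g (Icc t t')) (hf : ∀ u ∈ Ioo t t', HasDerivAt f (f' u) u)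
    (hg : ∀ u ∈ Ioo t t', HasDerivAt g (g' u) u) (gpos : ∀ u ∈ Icc t t', 0 < g u)
    (hw : ∀ u ∈ Ioo t t', f u * g' u < f' u * g u) : f t * g t' < f t' * g t := by
  have hmono : StrictMonoOn (fun u => f u / g u) (Icc t t') := by
    refine strictMonoOn_of_deriv_pos (convex_Icc t t') (cf.div cg fun u hu => (gpos u hu).ne')
      fun u hu => ?_
    rw [interior_Icc] at hu
    have hgu := gpos u (Ioo_subset_Icc_self hu)
    have := ((hf u hu).div (hg u hu) hgu.ne').deriv
    simp only [Pi.div_def] at this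
    rw [this]
    exact div_pos (sub_pos.2 (hw u hu)) (by positivity)
  have := hmono (left_mem_Icc.2 htt.le) (right_mem_Icc.2 htt.le) htt
  have h1 := gpos t (left_mem_Icc.2 htt.le)
  have h2 := gpos t' (right_mem_Icc.2 htt.le)
  simp only at this
  rwa [div_lt_div_iff₀ h1 h2] at this

namespace IsOn

variable {s e : ℝ} (H : C.IsOn s e)
include H

theorem hg : ∀ t ∈ Ioo s e, HasDerivAt C.g (C.x t * C.dm t) t := fun t ht => by
  refine HasDerivAt.congr_deriv (((H.hm t ht).mul (H.hx t ht)).sub (H.hy t ht)) ?_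
  ring

theorem hh : ∀ t ∈ Ioo s e, HasDerivAt C.h (C.m t * C.dk t) t := fun t ht => by
  refine HasDerivAt.congr_deriv (((H.hm t ht).mul (H.hk t ht)).sub (H.hl t ht)) ?_
  ring

theorem hw : ∀ t ∈ Ioo s e, HasDerivAt C.w (C.g t * C.dk t) t := fun t ht => by
  refine HasDerivAt.congr_deriv (((H.hz t ht).sub ((H.hk t ht).mul (H.hy t ht))).add
    ((H.hh t ht).mul (H.hx t ht))) ?_
  simp only [h, g]
  ring

theorem hj : ∀ t ∈ Ioo s e, HasDerivAt C.j (C.k t * C.x t * C.dm t) t := fun t ht => by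
  refine HasDerivAt.congr_deriv (((H.hl t ht).mul (H.hx t ht)).sub (H.hz t ht)) ?_
  ring

theorem hq : ∀ t ∈ Ioo s e, HasDerivAt C.q ((C.k t * C.y t - C.z t) * C.dm t) t :=
  fun t ht => by
  refine HasDerivAt.congr_deriv (((H.hl t ht).mul (H.hy t ht)).sub ((H.hm t ht).mul (H.hz t ht))) ?_
  ring

theorem cg : ContinuousOn C.g (Icc s e) := (H.cm.mul H.cx).sub H.cy
theorem ch : ContinuousOn C.h (Icc s e) := (H.cm.mul H.ck).sub H.cl
theorem cw : ContinuousOn C.w (Icc s e) := (H.cz.sub (H.ck.mul H.cy)).add (H.ch.mul H.cx)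
theorem cj : ContinuousOn C.j (Icc s e) := (H.cl.mul H.cx).sub H.cz
theorem cq : ContinuousOn C.q (Icc s e) := (H.cl.mul H.cy).sub (H.cm.mul H.cz)

theorem dual : C.dual.IsOn s e where
  cx := H.ck
  cy := H.ch
  cz := H.cw
  cm := H.cm
  cl := H.cg
  ck := H.cx
  hx := H.hk
  hy := H.hh
  hz := H.hw
  hm := H.hm
  hl := H.hg
  hk := H.hx
  px := H.pk
  pm := H.pm
  pk := H.px

end IsOn

namespace IsPinned

variable {s e : ℝ} (H : C.IsPinned s e)
include H

theorem dual : C.dual.IsPinned s e where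
  toIsOn := H.toIsOn.dual
  zx := H.zk
  zy := by simp [ChebyshevCurve.dual, h, H.zm, H.zl]
  zz := by simp [ChebyshevCurve.dual, w, H.zx, H.zk, H.zz]
  zm := H.zm
  zl := by simp [ChebyshevCurve.dual, g, H.zm, H.zy]
  zk := H.zx

theorem x_pos : ∀ t ∈ Ioc s e, 0 < C.x t := pos_of_deriv_pos H.cx H.hx H.px H.zx
theorem m_pos : ∀ t ∈ Ioc s e, 0 < C.m t := pos_of_deriv_pos H.cm H.hm H.pm H.zm
theorem k_pos : ∀ t ∈ Ioc s e, 0 < C.k t := pos_of_deriv_pos H.ck H.hk H.pk H.zk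

theorem y_pos : ∀ t ∈ Ioc s e, 0 < C.y t := pos_of_deriv_pos H.cy H.hy
  (fun t ht => mul_pos (H.m_pos t (Ioo_subset_Ioc_self ht)) (H.px t ht)) H.zy
theorem l_pos : ∀ t ∈ Ioc s e, 0 < C.l t := pos_of_deriv_pos H.cl H.hl
  (fun t ht => mul_pos (H.k_pos t (Ioo_subset_Ioc_self ht)) (H.pm t ht)) H.zl
theorem z_pos : ∀ t ∈ Ioc s e, 0 < C.z t := pos_of_deriv_pos H.cz H.hz
  (fun t ht => mul_pos (H.l_pos t (Ioo_subset_Ioc_self ht)) (H.px t ht)) H.zz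

theorem g_pos : ∀ t ∈ Ioc s e, 0 < C.g t := H.dual.l_pos
theorem h_pos : ∀ t ∈ Ioc s e, 0 < C.h t := H.dual.y_pos
theorem w_pos : ∀ t ∈ Ioc s e, 0 < C.w t := H.dual.z_pos

theorem j_pos : ∀ t ∈ Ioc s e, 0 < C.j t := pos_of_deriv_pos H.cj H.hj
  (fun t ht => mul_pos (mul_pos (H.k_pos t (Ioo_subset_Ioc_self ht))
    (H.x_pos t (Ioo_subset_Ioc_self ht))) (H.pm t ht)) (by simp [j, H.zx, H.zz])

theorem ky_sub_z_pos : ∀ t ∈ Ioc s e, 0 < C.k t * C.y t - C.z t := by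
  refine pos_of_deriv_pos (f := fun t => C.k t * C.y t - C.z t)
    (f' := fun t => C.dk t * C.y t + C.h t * C.dx t) ((H.ck.mul H.cy).sub H.cz)
    (fun t ht => ?_) (fun t ht => ?_) (by simp [H.zk, H.zz])
  · refine HasDerivAt.congr_deriv (((H.hk t ht).mul (H.hy t ht)).sub (H.hz t ht)) ?_
    simp only [h]; ring
  · exact add_pos (mul_pos (H.pk t ht) (H.y_pos t (Ioo_subset_Ioc_self ht)))
      (mul_pos (H.h_pos t (Ioo_subset_Ioc_self ht)) (H.px t ht))

theorem q_pos : ∀ t ∈ Ioc s e, 0 < C.q t := pos_of_deriv_pos H.cq H.hq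
  (fun t ht => mul_pos (H.ky_sub_z_pos t (Ioo_subset_Ioc_self ht)) (H.pm t ht))
  (by simp [q, H.zm, H.zl])

/-- The quotient `z / y` is increasing: its Wronskian is `dx * q`. -/
theorem z_div_y_lt {t t' : ℝ} (h1 : s < t) (h2 : t < t') (h3 : t' ≤ e) :
    C.z t * C.y t' < C.z t' * C.y t := by
  have K := H.toIsOn.mono h1.le h3
  refine ratio_lt h2 K.cz K.cy K.hz K.hy (fun u hu => H.y_pos u ⟨h1.trans_le hu.1, hu.2.trans h3⟩)
    fun u hu => ?_
  have := mul_pos (K.px u hu) (H.q_pos u ⟨h1.trans hu.1, hu.2.le.trans h3⟩)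
  simp only [q] at this
  linarith

/-- The quotient `l / m` is increasing: its Wronskian is `dm * h`. -/
theorem l_div_m_lt {t t' : ℝ} (h1 : s < t) (h2 : t < t') (h3 : t' ≤ e) :
    C.l t * C.m t' < C.l t' * C.m t := by
  have K := H.toIsOn.mono h1.le h3
  refine ratio_lt h2 K.cl K.cm K.hl K.hm (fun u hu => H.m_pos u ⟨h1.trans_le hu.1, hu.2.trans h3⟩)
    fun u hu => ?_
  have := mul_pos (K.pm u hu) (H.h_pos u ⟨h1.trans hu.1, hu.2.le.trans h3⟩)
  simp only [h] at this
  linarith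

/-- The quotient `j / g` is increasing: its Wronskian is `dm * w * x`. -/
theorem j_div_g_lt {t t' : ℝ} (h1 : s < t) (h2 : t < t') (h3 : t' ≤ e) :
    C.j t * C.g t' < C.j t' * C.g t := by
  have K := H.toIsOn.mono h1.le h3
  refine ratio_lt h2 K.cj K.cg K.hj K.hg (fun u hu => H.g_pos u ⟨h1.trans_le hu.1, hu.2.trans h3⟩)
    fun u hu => ?_
  have hu' : u ∈ Ioc s e := ⟨h1.trans hu.1, hu.2.le.trans h3⟩
  have := mul_pos (mul_pos (K.pm u hu) (H.w_pos u hu')) (H.x_pos u hu')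
  simp only [w, h, g, j] at this ⊢
  linarith

/-- The quotient `q / j` is increasing: its Wronskian is `dm * w * z`. -/
theorem q_div_j_lt {t t' : ℝ} (h1 : s < t) (h2 : t < t') (h3 : t' ≤ e) :
    C.q t * C.j t' < C.q t' * C.j t := by
  have K := H.toIsOn.mono h1.le h3
  refine ratio_lt h2 K.cq K.cj K.hq K.hj (fun u hu => H.j_pos u ⟨h1.trans_le hu.1, hu.2.trans h3⟩)
    fun u hu => ?_
  have hu' : u ∈ Ioc s e := ⟨h1.trans hu.1, hu.2.le.trans h3⟩
  have := mul_pos (mul_pos (K.pm u hu) (H.w_pos u hu')) (H.z_pos u hu')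
  simp only [w, h, q, j] at this ⊢
  linarith

/-- The plane through the starting point and the tangent line at `t` meets the curve nowhere
else. Divided by `x τ`, its equation along the curve decreases before `t` and increases after `t`,
by the monotonicity of `j / g`. -/
theorem plane_pos {t τ : ℝ} (ht : t ∈ Ioc s e) (hτ : τ ∈ Ioc s e) (hne : t ≠ τ) :
    0 < C.q t * C.x τ - C.j t * C.y τ + C.g t * C.z τ := by
  have h0 : C.q t * C.x t - C.j t * C.y t + C.g t * C.z t = 0 := by
    simp only [q, j, g]; ring
  rcases hne.lt_or_gt with hlt | hlt
  · have K := H.toIsOn.mono ht.1.le hτ.2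
    have := ratio_lt (f := fun u => C.q t * C.x u - C.j t * C.y u + C.g t * C.z u)
      (f' := fun u => C.q t * C.dx u - C.j t * (C.m u * C.dx u) + C.g t * (C.l u * C.dx u))
      hlt (((K.cx.const_mul _).sub (K.cy.const_mul _)).add (K.cz.const_mul _)) K.cx
      (fun u hu => (((K.hx u hu).const_mul _).sub ((K.hy u hu).const_mul _)).add
        ((K.hz u hu).const_mul _)) K.hx
      (fun u hu => H.x_pos u ⟨ht.1.trans_le hu.1, hu.2.trans hτ.2⟩) (fun u hu => by
        have h1 := mul_pos (K.px u hu)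
          (sub_pos.2 (H.j_div_g_lt ht.1 hu.1 (hu.2.le.trans hτ.2)))
        have h2 : (C.q t * C.dx u - C.j t * (C.m u * C.dx u) + C.g t * (C.l u * C.dx u)) * C.x u
            - (C.q t * C.x u - C.j t * C.y u + C.g t * C.z u) * C.dx u
            = C.dx u * (C.j u * C.g t - C.j t * C.g u) := by
          simp only [q, j, g]; ring
        linarith)
    simp only [h0, zero_mul] at this
    exact pos_of_mul_pos_left this (H.x_pos t ht).le
  · have K := H.toIsOn.mono hτ.1.le ht.2
    have := ratio_lt (f := fun u => -(C.q t * C.x u - C.j t * C.y u + C.g t * C.z u))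
      (f' := fun u => -(C.q t * C.dx u - C.j t * (C.m u * C.dx u) + C.g t * (C.l u * C.dx u)))
      hlt (((K.cx.const_mul _).sub (K.cy.const_mul _)).add (K.cz.const_mul _)).neg K.cx
      (fun u hu => ((((K.hx u hu).const_mul _).sub ((K.hy u hu).const_mul _)).add
        ((K.hz u hu).const_mul _)).neg) K.hx
      (fun u hu => H.x_pos u ⟨hτ.1.trans_le hu.1, hu.2.trans ht.2⟩) (fun u hu => by
        have h1 := mul_pos (K.px u hu)
          (sub_pos.2 (H.j_div_g_lt (hτ.1.trans hu.1) hu.2 ht.2))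
        have h2 : (C.q t * C.dx u - C.j t * (C.m u * C.dx u) + C.g t * (C.l u * C.dx u)) * C.x u
            - (C.q t * C.x u - C.j t * C.y u + C.g t * C.z u) * C.dx u
            = C.dx u * (C.j u * C.g t - C.j t * C.g u) := by
          simp only [q, j, g]; ring
        linarith)
    simp only [h0, neg_zero, zero_mul] at this
    by_contra hcon
    have := mul_nonneg (neg_nonneg.2 (not_lt.1 hcon)) (H.x_pos t ht).le
    linarith

/-- The two planes through the chord of the segment and an end tangent: the quotient of their
equations increases along the curve. The Wronskian at `u` is `dx u * q e` times the equation of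
`plane_pos` for the tangent at `u`, evaluated at the end point. -/
theorem chord_planes_lt {t t' : ℝ} (h1 : s < t) (h2 : t < t') (h3 : t' < e) :
    (C.z e * C.y t - C.y e * C.z t) * (C.q e * C.x t' - C.j e * C.y t' + C.g e * C.z t') <
    (C.z e * C.y t' - C.y e * C.z t') * (C.q e * C.x t - C.j e * C.y t + C.g e * C.z t) := by
  have K := H.toIsOn.mono h1.le h3.le
  have he : e ∈ Ioc s e := ⟨by linarith, le_rfl⟩
  refine ratio_lt (f := fun u => C.z e * C.y u - C.y e * C.z u)
      (f' := fun u => C.z e * (C.m u * C.dx u) - C.y e * (C.l u * C.dx u))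
      (g := fun u => C.q e * C.x u - C.j e * C.y u + C.g e * C.z u)
      (g' := fun u => C.q e * C.dx u - C.j e * (C.m u * C.dx u) + C.g e * (C.l u * C.dx u))
      h2 ((K.cy.const_mul _).sub (K.cz.const_mul _))
      (((K.cx.const_mul _).sub (K.cy.const_mul _)).add (K.cz.const_mul _))
      (fun u hu => ((K.hy u hu).const_mul _).sub ((K.hz u hu).const_mul _))
      (fun u hu => (((K.hx u hu).const_mul _).sub ((K.hy u hu).const_mul _)).add
        ((K.hz u hu).const_mul _))
      (fun u hu => H.plane_pos he ⟨by linarith [hu.1], by linarith [hu.2]⟩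
        (by linarith [hu.2] : u < e).ne') fun u hu => ?_
  have hu' : u ∈ Ioc s e := ⟨h1.trans hu.1, (hu.2.trans h3).le⟩
  have := mul_pos (mul_pos (K.px u hu) (H.q_pos e he))
    (H.plane_pos hu' he (hu.2.trans h3).ne)
  simp only [q, j, g] at this ⊢
  linarith

end IsPinned

end ChebyshevCurve

/-! ### The control tetrahedron of a Chebyshev curve in coordinates -/

namespace ChebyshevCurve

variable (C : ChebyshevCurve)

/-- Parameter on the tangent at `s` of its intersection with the osculating plane at `e`. -/
def u (s e : ℝ) : ℝ := -C.phiAt e s / C.lam e s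

/-- Parameter on the backward tangent at `e` of its intersection with the osculating plane
at `s`. -/
def v (s e : ℝ) : ℝ := C.phiAt s e / C.lam s e

/-- First coordinates of the vertices of the control tetrahedron of `[s, e]`. -/
def vx (s e : ℝ) : Fin 4 → ℝ := ![C.x s, C.x s + C.u s e, C.x e - C.v s e, C.x e]

/-- Second coordinates of the vertices of the control tetrahedron of `[s, e]`. -/
def vy (s e : ℝ) : Fin 4 → ℝ :=
  ![C.y s, C.y s + C.u s e * C.m s, C.y e - C.v s e * C.m e, C.y e]

/-- Third coordinates of the vertices of the control tetrahedron of `[s, e]`. -/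
def vz (s e : ℝ) : Fin 4 → ℝ :=
  ![C.z s, C.z s + C.u s e * C.l s, C.z e - C.v s e * C.l e, C.z e]

/-- The `i`-th function is affine, vanishes on the face opposite to the `i`-th vertex of the
control tetrahedron of `[s, e]`, and is positive at that vertex. -/
def face (s e : ℝ) (i : Fin 4) (X Y Z : ℝ) : ℝ :=
  ![-C.phi e X Y Z, C.betaAt e s * C.phi e X Y Z - C.phiAt e s * C.beta e X Y,
    C.phiAt s e * C.beta s X Y - C.betaAt s e * C.phi s X Y Z, C.phi s X Y Z] i

/-! #### Invariance under change of flag and under reversal -/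

section invariance
variable {C}

theorem lam_pin (c s t : ℝ) : (C.pin c).lam s t = C.lam s t := by
  simp only [pin, lam]; ring

theorem phi_pin (c t X Y Z : ℝ) :
    (C.pin c).phi t (X - C.x c) (C.beta c X Y) (C.phi c X Y Z) = C.phi t X Y Z := by
  simp only [pin, phi, beta, betaAt, phiAt, lam]; ring

theorem beta_pin (c t X Y : ℝ) :
    (C.pin c).beta t (X - C.x c) (C.beta c X Y) = C.beta t X Y := by
  simp only [pin, beta, betaAt]; ring

theorem phiAt_pin (c s t : ℝ) : (C.pin c).phiAt s t = C.phiAt s t :=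
  phi_pin c s (C.x t) (C.y t) (C.z t)

theorem betaAt_pin (c s t : ℝ) : (C.pin c).betaAt s t = C.betaAt s t :=
  beta_pin c s (C.x t) (C.y t)

theorem u_pin (c s e : ℝ) : (C.pin c).u s e = C.u s e := by
  simp only [u, lam_pin, phiAt_pin]

theorem v_pin (c s e : ℝ) : (C.pin c).v s e = C.v s e := by
  simp only [v, lam_pin, phiAt_pin]

theorem face_pin (c s e : ℝ) (i : Fin 4) (X Y Z : ℝ) :
    (C.pin c).face s e i (X - C.x c) (C.beta c X Y) (C.phi c X Y Z) = C.face s e i X Y Z := by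
  simp only [face, phi_pin, beta_pin, phiAt_pin, betaAt_pin]

theorem vx_pin (c s e : ℝ) (i : Fin 4) : (C.pin c).vx s e i = C.vx s e i - C.x c := by
  fin_cases i <;> simp only [vx, u_pin, v_pin] <;> simp [pin] <;> ring

theorem vy_pin (c s e : ℝ) (i : Fin 4) :
    (C.pin c).vy s e i = C.beta c (C.vx s e i) (C.vy s e i) := by
  fin_cases i <;> simp only [vx, vy, u_pin, v_pin] <;> simp [pin, betaAt, beta] <;> ring

theorem vz_pin (c s e : ℝ) (i : Fin 4) :
    (C.pin c).vz s e i = C.phi c (C.vx s e i) (C.vy s e i) (C.vz s e i) := by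
  fin_cases i <;> simp only [vx, vy, vz, u_pin, v_pin] <;>
    simp [pin, phiAt, phi, lam] <;> ring

theorem phi_reverse (t X Y Z : ℝ) : C.reverse.phi (-t) (-X) Y (-Z) = -C.phi t X Y Z := by
  simp only [reverse, phi, neg_neg]; ring

theorem beta_reverse (t X Y : ℝ) : C.reverse.beta (-t) (-X) Y = C.beta t X Y := by
  simp only [reverse, beta, neg_neg]; ring

theorem lam_reverse (s t : ℝ) : C.reverse.lam (-s) (-t) = C.lam s t := by
  simp only [reverse, lam, neg_neg]; ring

theorem phiAt_reverse (s t : ℝ) : C.reverse.phiAt (-s) (-t) = -C.phiAt s t := by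
  simp only [reverse, phiAt, phi, neg_neg]; ring

theorem betaAt_reverse (s t : ℝ) : C.reverse.betaAt (-s) (-t) = C.betaAt s t := by
  simp only [reverse, betaAt, beta, neg_neg]; ring

theorem u_reverse (s e : ℝ) : C.reverse.u (-e) (-s) = C.v s e := by
  simp only [u, v, phiAt_reverse, lam_reverse, neg_neg]

theorem v_reverse (s e : ℝ) : C.reverse.v (-e) (-s) = C.u s e := by
  simp only [u, v, phiAt_reverse, lam_reverse]

theorem face_reverse (s e : ℝ) (i : Fin 4) (X Y Z : ℝ) :
    C.reverse.face (-e) (-s) i (-X) Y (-Z) = C.face s e i.rev X Y Z := by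
  simp only [face, phi_reverse, beta_reverse, phiAt_reverse, betaAt_reverse]
  fin_cases i <;> simp [Fin.rev] <;> ring

theorem vx_reverse (s e : ℝ) (i : Fin 4) : C.reverse.vx (-e) (-s) i = -C.vx s e i.rev := by
  simp only [vx, u_reverse, v_reverse]
  fin_cases i <;> simp [Fin.rev, reverse]
  all_goals ring

theorem vy_reverse (s e : ℝ) (i : Fin 4) : C.reverse.vy (-e) (-s) i = C.vy s e i.rev := by
  simp only [vy, u_reverse, v_reverse]
  fin_cases i <;> simp [Fin.rev, reverse]
  ring

theorem vz_reverse (s e : ℝ) (i : Fin 4) : C.reverse.vz (-e) (-s) i = -C.vz s e i.rev := by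
  simp only [vz, u_reverse, v_reverse]
  fin_cases i <;> simp [Fin.rev, reverse] <;> ring

theorem dual_g (t : ℝ) : C.dual.g t = C.l t := by simp only [dual, g, h]; ring
theorem dual_j (t : ℝ) : C.dual.j t = C.j t := by simp only [dual, j, g, w, h]; ring
theorem dual_q (t : ℝ) : C.dual.q t = C.q t := by simp only [dual, q, g, w, h]; ring

end invariance

/-! #### Pinned curves -/

namespace IsPinned
variable {C} {s e : ℝ} (H : C.IsPinned s e)
include H

theorem phi_start (X Y Z : ℝ) : C.phi s X Y Z = Z := by
  simp [phi, H.zx, H.zy, H.zz, H.zk, H.zm, H.zl]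
theorem beta_start (X Y : ℝ) : C.beta s X Y = Y := by simp [beta, H.zx, H.zy, H.zm]
theorem lam_start (t : ℝ) : C.lam s t = C.l t := by simp [lam, H.zl, H.zk]
theorem lam_to_start (t : ℝ) : C.lam t s = C.h t := by simp [lam, h, H.zl, H.zm]; ring
theorem phiAt_start (t : ℝ) : C.phiAt s t = C.z t := H.phi_start _ _ _
theorem betaAt_start (t : ℝ) : C.betaAt s t = C.y t := H.beta_start _ _
theorem phiAt_to_start (t : ℝ) : C.phiAt t s = -C.w t := by
  simp [phiAt, phi, w, h, H.zx, H.zy, H.zz]; ring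
theorem betaAt_to_start (t : ℝ) : C.betaAt t s = C.g t := by
  simp [betaAt, beta, g, H.zx, H.zy]; ring
theorem u_eq (t : ℝ) : C.u s t = C.w t / C.h t := by
  simp [u, H.phiAt_to_start, H.lam_to_start]
theorem v_eq (t : ℝ) : C.v s t = C.z t / C.l t := by
  simp [v, H.phiAt_start, H.lam_start]

theorem face_eq (t : ℝ) (i : Fin 4) (X Y Z : ℝ) : C.face s t i X Y Z =
    ![C.w t - C.h t * X + C.k t * Y - Z, C.q t * X - C.j t * Y + C.g t * Z,
      C.z t * Y - C.y t * Z, Z] i := by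
  simp only [face, H.phiAt_to_start, H.betaAt_to_start, H.phiAt_start, H.betaAt_start,
    H.phi_start, H.beta_start]
  fin_cases i <;> simp [phi, beta, w, h, g, j, q] <;> ring

theorem vx_eq {t : ℝ} (ht : t ∈ Ioc s e) (i : Fin 4) :
    C.vx s t i = ![0, C.w t / C.h t, C.j t / C.l t, C.x t] i := by
  have := (H.l_pos t ht).ne'
  fin_cases i <;> simp [vx, H.zx, H.u_eq, H.v_eq, j]
  field_simp

theorem vy_eq {t : ℝ} (ht : t ∈ Ioc s e) (i : Fin 4) :
    C.vy s t i = ![0, 0, C.q t / C.l t, C.y t] i := by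
  have := (H.l_pos t ht).ne'
  fin_cases i <;> simp [vy, H.zy, H.zm, H.u_eq, H.v_eq, q]
  field_simp

theorem vz_eq {t : ℝ} (ht : t ∈ Ioc s e) (i : Fin 4) :
    C.vz s t i = ![0, 0, 0, C.z t] i := by
  have := (H.l_pos t ht).ne'
  fin_cases i <;> simp [vz, H.zz, H.zl, H.u_eq, H.v_eq]
  field_simp
  ring

theorem face_vert {t : ℝ} (ht : t ∈ Ioc s e) {i j : Fin 4} (hij : i ≠ j) :
    C.face s t i (C.vx s t j) (C.vy s t j) (C.vz s t j) = 0 := by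
  have := (H.l_pos t ht).ne'
  have := (H.h_pos t ht).ne'
  rw [H.face_eq, H.vx_eq ht, H.vy_eq ht, H.vz_eq ht]
  fin_cases i <;> fin_cases j <;> simp at hij ⊢ <;> field_simp <;>
    first | ring1 | (simp only [w, h, g, ChebyshevCurve.j, q]; ring)

theorem face_vert_pos {t : ℝ} (ht : t ∈ Ioc s e) (i : Fin 4) :
    0 < C.face s t i (C.vx s t i) (C.vy s t i) (C.vz s t i) := by
  have h1 := H.l_pos t ht
  have h2 := H.h_pos t ht
  have h3 := H.w_pos t ht
  have h4 := H.z_pos t ht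
  have h5 := H.q_pos t ht
  rw [H.face_eq, H.vx_eq ht, H.vy_eq ht, H.vz_eq ht]
  fin_cases i <;> simp <;> positivity

/-- The inner vertices of the control tetrahedron of `[s, τ]` lie in that of `[s, e]`. The vertex
`P 1` is controlled by the growth of `w / h`, the vertex `P 2` by that of `q / j`. -/
theorem face_left {τ : ℝ} (h1 : s < τ) (h2 : τ ≤ e) (hpos : C.phiAt e τ ≤ 0)
    (hlam : 0 ≤ C.lam e τ) (i a : Fin 4) (ha : a = 1 ∨ a = 2) :
    0 ≤ C.face s e i (C.vx s τ a) (C.vy s τ a) (C.vz s τ a) := by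
  have hτ : τ ∈ Ioc s e := ⟨h1, h2⟩
  have he : e ∈ Ioc s e := ⟨h1.trans_le h2, le_rfl⟩
  have l1 := H.l_pos τ hτ
  have l2 := H.h_pos τ hτ
  have l3 := H.w_pos τ hτ
  have l4 := H.z_pos τ hτ
  have l5 := H.q_pos τ hτ
  have e1 := H.q_pos e he
  have e2 := H.z_pos e he
  have hwh : C.w τ * C.h e ≤ C.w e * C.h τ := by
    rcases h2.eq_or_lt with rfl | hlt
    · exact le_rfl
    · exact (H.dual.z_div_y_lt h1 hlt le_rfl).le
  have hqj : C.q τ * C.j e ≤ C.q e * C.j τ := by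
    rcases h2.eq_or_lt with rfl | hlt
    · exact le_rfl
    · exact (H.q_div_j_lt h1 hlt le_rfl).le
  rw [H.face_eq, H.vx_eq hτ, H.vy_eq hτ, H.vz_eq hτ]
  rcases ha with rfl | rfl
  · fin_cases i <;> simp
    · rw [mul_div_assoc', div_le_iff₀ l2]; linarith
    · positivity
  · fin_cases i <;> simp
    · -- The vertex is `r(τ) - v • B(τ)` with `v = z / l ≥ 0`.
      have : C.w e - C.h e * (C.j τ / C.l τ) + C.k e * (C.q τ / C.l τ) =
          -C.phiAt e τ + C.z τ / C.l τ * C.lam e τ := by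
        field_simp
        simp only [w, h, j, q, phiAt, phi, lam]
        ring
      rw [← sub_nonneg]
      have h3 := mul_nonneg (div_nonneg l4.le l1.le) hlam
      linarith
    · rw [mul_div_assoc', mul_div_assoc', div_le_div_iff_of_pos_right l1]; linarith
    · positivity

/-- Motion of the osculating plane along the edge `P 0 P 1`. -/
theorem osc_edge₀₁ {t t' : ℝ} (h1 : s < t) (h2 : t < t') (h3 : t' < e) :
    -C.phi t (C.vx s e 0) (C.vy s e 0) (C.vz s e 0) *
      C.phi t' (C.vx s e 1) (C.vy s e 1) (C.vz s e 1) <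
    -C.phi t' (C.vx s e 0) (C.vy s e 0) (C.vz s e 0) *
      C.phi t (C.vx s e 1) (C.vy s e 1) (C.vz s e 1) := by
  have he : e ∈ Ioc s e := ⟨by linarith, le_rfl⟩
  have key : C.w t * C.h t' < C.w t' * C.h t := H.dual.z_div_y_lt h1 h2 h3.le
  have hpos : 0 < C.w e / C.h e := div_pos (H.w_pos e he) (H.h_pos e he)
  rw [H.vx_eq he, H.vy_eq he, H.vz_eq he, H.vx_eq he, H.vy_eq he, H.vz_eq he]
  have e0 : ∀ τ, C.phi τ 0 0 0 = -C.w τ := fun τ => by simp only [phi, w, h]; ring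
  have e1 : ∀ τ X, C.phi τ X 0 0 = C.h τ * X - C.w τ := fun τ X => by
    simp only [phi, w, h]; ring
  simp only [Matrix.cons_val, e0, e1, neg_neg]
  nlinarith [mul_pos hpos (sub_pos.2 key)]

theorem phi_vert_one_pos {t : ℝ} (h1 : s < t) (h3 : t < e) :
    0 < C.phi t (C.vx s e 1) (C.vy s e 1) (C.vz s e 1) := by
  have he : e ∈ Ioc s e := ⟨by linarith, le_rfl⟩
  have key : C.w t * C.h e < C.w e * C.h t := H.dual.z_div_y_lt h1 h3 le_rfl
  have hpos := H.h_pos e he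
  rw [H.vx_eq he, H.vy_eq he, H.vz_eq he]
  have e1 : ∀ X, C.phi t X 0 0 = C.h t * X - C.w t := fun X => by
    simp only [phi, w, h]; ring
  simp only [Matrix.cons_val, e1]
  rw [sub_pos, mul_div_assoc', lt_div_iff₀ hpos]
  linarith

/-- Motion of the osculating plane along the edge `P 1 P 2`; this is dual to the motion of the
plane through the chord and the point of the curve. -/
theorem osc_edge₁₂ {t t' : ℝ} (h1 : s < t) (h2 : t < t') (h3 : t' < e) :
    C.phi t (C.vx s e 1) (C.vy s e 1) (C.vz s e 1) *
      -C.phi t' (C.vx s e 2) (C.vy s e 2) (C.vz s e 2) <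
    C.phi t' (C.vx s e 1) (C.vy s e 1) (C.vz s e 1) *
      -C.phi t (C.vx s e 2) (C.vy s e 2) (C.vz s e 2) := by
  have he : e ∈ Ioc s e := ⟨by linarith, le_rfl⟩
  have key := H.dual.chord_planes_lt h1 h2 h3
  simp only [dual_g, dual_j, dual_q] at key
  simp only [ChebyshevCurve.dual] at key
  have hh := H.h_pos e he
  have hl := H.l_pos e he
  rw [H.vx_eq he, H.vy_eq he, H.vz_eq he, H.vx_eq he, H.vy_eq he, H.vz_eq he]
  have e1 : ∀ τ, C.phi τ (C.w e / C.h e) 0 0 = (C.w e * C.h τ - C.h e * C.w τ) / C.h e :=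
    fun τ => by
      have : C.phi τ (C.w e / C.h e) 0 0 = C.h τ * (C.w e / C.h e) - C.w τ := by
        simp only [phi, w, h]; ring
      rw [this]; field_simp
  have e2 : ∀ τ, -C.phi τ (C.j e / C.l e) (C.q e / C.l e) 0 =
      (C.q e * C.k τ - C.j e * C.h τ + C.l e * C.w τ) / C.l e := fun τ => by
    have : C.phi τ (C.j e / C.l e) (C.q e / C.l e) 0 =
        C.h τ * (C.j e / C.l e) - C.k τ * (C.q e / C.l e) - C.w τ := by
      simp only [phi, w, h]; ring
    rw [this]; field_simp; ring
  simp only [Matrix.cons_val, e1, e2, div_mul_div_comm]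
  exact div_lt_div_of_pos_right key (mul_pos hh hl)

/-- There is at most one point where the curve is parallel to the plane through the tangent at
`s` and the end point. -/
theorem face_two_critical {t t' : ℝ} (h1 : s < t) (h2 : t < t') (h3 : t' ≤ e)
    (hz : C.phiAt s e * (C.m t - C.m s) - C.betaAt s e * C.lam s t = 0)
    (hz' : C.phiAt s e * (C.m t' - C.m s) - C.betaAt s e * C.lam s t' = 0) : False := by
  simp only [H.phiAt_start, H.betaAt_start, H.lam_start, H.zm, sub_zero] at hz hz'
  have key := H.l_div_m_lt h1 h2 h3
  have hy := H.y_pos e ⟨by linarith, le_rfl⟩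
  have := mul_lt_mul_of_pos_left key hy
  exact this.ne (by linear_combination C.m t * hz' - C.m t' * hz)

end IsPinned

/-! #### Arbitrary Chebyshev curves -/

namespace IsOn
variable {C} {a b : ℝ} (H : C.IsOn a b)
include H

theorem phiAt_pos {s t : ℝ} (h1 : a ≤ s) (h2 : s < t) (h3 : t ≤ b) : 0 < C.phiAt s t :=
  (H.pin h1 h3).z_pos t ⟨h2, le_rfl⟩

theorem lam_pos {s t : ℝ} (h1 : a ≤ s) (h2 : s < t) (h3 : t ≤ b) : 0 < C.lam s t :=
  (H.pin h1 h3).l_pos t ⟨h2, le_rfl⟩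

theorem phiAt_neg {s t : ℝ} (h1 : a ≤ s) (h2 : s < t) (h3 : t ≤ b) : C.phiAt t s < 0 := by
  have := H.reverse.phiAt_pos (s := -t) (t := -s) (by linarith) (by linarith) (by linarith)
  rw [phiAt_reverse] at this
  linarith

theorem lam_pos' {s t : ℝ} (h1 : a ≤ s) (h2 : s < t) (h3 : t ≤ b) : 0 < C.lam t s := by
  have := H.reverse.lam_pos (s := -t) (t := -s) (by linarith) (by linarith) (by linarith)
  rwa [lam_reverse] at this

theorem u_pos {s t : ℝ} (h1 : a ≤ s) (h2 : s < t) (h3 : t ≤ b) : 0 < C.u s t :=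
  div_pos (neg_pos.2 (H.phiAt_neg h1 h2 h3)) (H.lam_pos' h1 h2 h3)

theorem v_pos {s t : ℝ} (h1 : a ≤ s) (h2 : s < t) (h3 : t ≤ b) : 0 < C.v s t :=
  div_pos (H.phiAt_pos h1 h2 h3) (H.lam_pos h1 h2 h3)

variable {s e : ℝ} (has : a ≤ s) (heb : e ≤ b)
include has heb

theorem face_vert (hse : s < e) {i j : Fin 4} (hij : i ≠ j) :
    C.face s e i (C.vx s e j) (C.vy s e j) (C.vz s e j) = 0 := by
  have := (H.pin has heb).face_vert ⟨hse, le_rfl⟩ hij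
  rwa [vx_pin, vy_pin, vz_pin, face_pin] at this

theorem face_vert_pos (hse : s < e) (i : Fin 4) :
    0 < C.face s e i (C.vx s e i) (C.vy s e i) (C.vz s e i) := by
  have := (H.pin has heb).face_vert_pos ⟨hse, le_rfl⟩ i
  rwa [vx_pin, vy_pin, vz_pin, face_pin] at this

/-- The open segment lies in the interior of its control tetrahedron. -/
theorem face_curve_pos {t : ℝ} (h1 : s < t) (h2 : t < e) (i : Fin 4) :
    0 < C.face s e i (C.x t) (C.y t) (C.z t) := by
  have K := H.pin has heb
  have ht : t ∈ Ioc s e := ⟨h1, h2.le⟩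
  have h3 : (C.pin s).face s e 3 (C.x t - C.x s) (C.beta s (C.x t) (C.y t))
      (C.phi s (C.x t) (C.y t) (C.z t)) = _ := K.face_eq e 3 _ _ _
  have key : ∀ i, 0 < (C.pin s).face s e i ((C.pin s).x t) ((C.pin s).y t) ((C.pin s).z t) := by
    intro i
    rcases eq_or_ne i 0 with rfl | hi
    · have := H.phiAt_neg (has.trans h1.le) h2 heb
      have h4 : 0 < -(C.pin s).phiAt e t := by rw [phiAt_pin]; linarith
      exact h4
    · rw [K.face_eq]
      fin_cases i
      · simp at hi
      · exact K.plane_pos ⟨h1.trans h2, le_rfl⟩ ht h2.ne'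
      · have := K.z_div_y_lt h1 h2 le_rfl
        simp; linarith
      · exact K.z_pos t ht
  have := key i
  rwa [← face_pin s s e i]

/-- Shrinking the segment at its right end shrinks the control tetrahedron. -/
theorem face_left {τ : ℝ} (h1 : s < τ) (h2 : τ ≤ e) (i j : Fin 4) (hj : j = 1 ∨ j = 2) :
    0 ≤ C.face s e i (C.vx s τ j) (C.vy s τ j) (C.vz s τ j) := by
  have hp : C.phiAt e τ ≤ 0 := by
    rcases h2.eq_or_lt with rfl | hlt
    · simp [phiAt, phi]
    · exact (H.phiAt_neg (has.trans h1.le) hlt heb).le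
  have hl : 0 ≤ C.lam e τ := by
    rcases h2.eq_or_lt with rfl | hlt
    · simp [lam]
    · exact (H.lam_pos' (has.trans h1.le) hlt heb).le
  have := (H.pin has heb).face_left h1 h2 (by rwa [phiAt_pin]) (by rwa [lam_pin]) i j hj
  rwa [vx_pin, vy_pin, vz_pin, face_pin] at this

/-- Shrinking the segment at its left end shrinks the control tetrahedron. -/
theorem face_right {σ : ℝ} (h1 : s ≤ σ) (h2 : σ < e) (i j : Fin 4) (hj : j = 1 ∨ j = 2) :
    0 ≤ C.face s e i (C.vx σ e j) (C.vy σ e j) (C.vz σ e j) := by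
  have := H.reverse.face_left (s := -e) (e := -s) (τ := -σ) (by linarith) (by linarith)
    (by linarith) (by linarith) i.rev j.rev
    (by rcases hj with rfl | rfl <;> decide)
  rwa [vx_reverse, vy_reverse, vz_reverse, face_reverse, Fin.rev_rev, Fin.rev_rev] at this

theorem phi_vert_one_pos {t : ℝ} (h1 : s < t) (h2 : t < e) :
    0 < C.phi t (C.vx s e 1) (C.vy s e 1) (C.vz s e 1) := by
  have := (H.pin has heb).phi_vert_one_pos h1 h2
  rwa [vx_pin, vy_pin, vz_pin, phi_pin] at this

theorem phi_vert_two_neg {t : ℝ} (h1 : s < t) (h2 : t < e) :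
    C.phi t (C.vx s e 2) (C.vy s e 2) (C.vz s e 2) < 0 := by
  have := H.reverse.phi_vert_one_pos (s := -e) (e := -s) (t := -t) (by linarith) (by linarith)
    (by linarith) (by linarith)
  rw [vx_reverse, vy_reverse, vz_reverse, phi_reverse] at this
  exact neg_pos.1 this

theorem osc_edge₀₁ {t t' : ℝ} (h1 : s < t) (h2 : t < t') (h3 : t' < e) :
    -C.phi t (C.vx s e 0) (C.vy s e 0) (C.vz s e 0) *
      C.phi t' (C.vx s e 1) (C.vy s e 1) (C.vz s e 1) <
    -C.phi t' (C.vx s e 0) (C.vy s e 0) (C.vz s e 0) *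
      C.phi t (C.vx s e 1) (C.vy s e 1) (C.vz s e 1) := by
  have := (H.pin has heb).osc_edge₀₁ h1 h2 h3
  simpa only [vx_pin, vy_pin, vz_pin, phi_pin] using this

theorem osc_edge₁₂ {t t' : ℝ} (h1 : s < t) (h2 : t < t') (h3 : t' < e) :
    C.phi t (C.vx s e 1) (C.vy s e 1) (C.vz s e 1) *
      -C.phi t' (C.vx s e 2) (C.vy s e 2) (C.vz s e 2) <
    C.phi t' (C.vx s e 1) (C.vy s e 1) (C.vz s e 1) *
      -C.phi t (C.vx s e 2) (C.vy s e 2) (C.vz s e 2) := by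
  have := (H.pin has heb).osc_edge₁₂ h1 h2 h3
  simpa only [vx_pin, vy_pin, vz_pin, phi_pin] using this

theorem osc_edge₂₃ {t t' : ℝ} (h1 : s < t) (h2 : t < t') (h3 : t' < e) :
    -C.phi t (C.vx s e 2) (C.vy s e 2) (C.vz s e 2) *
      C.phi t' (C.vx s e 3) (C.vy s e 3) (C.vz s e 3) <
    -C.phi t' (C.vx s e 2) (C.vy s e 2) (C.vz s e 2) *
      C.phi t (C.vx s e 3) (C.vy s e 3) (C.vz s e 3) := by
  have := H.reverse.osc_edge₀₁ (s := -e) (e := -s) (t := -t') (t' := -t) (by linarith)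
    (by linarith) (by linarith) (by linarith) (by linarith)
  simp only [vx_reverse, vy_reverse, vz_reverse, phi_reverse] at this
  have r0 : Fin.rev (0 : Fin 4) = 3 := rfl
  have r1 : Fin.rev (1 : Fin 4) = 2 := rfl
  rw [r0, r1] at this
  linarith

theorem phiAt_lt {t t' : ℝ} (h1 : s < t) (h2 : t < t') (h3 : t' ≤ e) :
    C.phiAt s t < C.phiAt s t' := by
  have K := H.pin has heb
  have hmono : StrictMonoOn (C.pin s).z (Icc s e) := by
    refine strictMonoOn_of_deriv_pos (convex_Icc s e) K.cz fun u hu => ?_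
    rw [interior_Icc] at hu
    rw [(K.hz u hu).deriv]
    exact mul_pos (K.l_pos u (Ioo_subset_Ioc_self hu)) (K.px u hu)
  exact hmono ⟨h1.le, by linarith⟩ ⟨by linarith, h3⟩ h2

/-- Motion of the plane through `P 1`, `P 2` and the point of the curve along `P 0 P 3`. -/
theorem face_edge₀₃ {t t' : ℝ} (h1 : s < t) (h2 : t < t') (h3 : t' < e) :
    C.face s e 3 (C.x t) (C.y t) (C.z t) * C.face s e 0 (C.x t') (C.y t') (C.z t') <
    C.face s e 3 (C.x t') (C.y t') (C.z t') * C.face s e 0 (C.x t) (C.y t) (C.z t) := by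
  have e1 : C.phiAt s t < C.phiAt s t' := H.phiAt_lt has heb h1 h2 h3.le
  have e2 : -C.phiAt e t' < -C.phiAt e t := by
    have := H.reverse.phiAt_lt (s := -e) (e := -s) (t := -t') (t' := -t) (by linarith)
      (by linarith) (by linarith) (by linarith) (by linarith)
    simpa only [phiAt_reverse] using this
  have e3 := H.phiAt_pos has h1 (by linarith)
  have e4 := H.phiAt_neg (has.trans (h1.trans h2).le) h3 heb
  exact mul_lt_mul'' e1 e2 e3.le (neg_nonneg.2 e4.le)

/-- Motion of the plane through `P 0`, `P 3` and the point of the curve along `P 1 P 2`. -/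
theorem face_edge₁₂ {t t' : ℝ} (h1 : s < t) (h2 : t < t') (h3 : t' < e) :
    C.face s e 2 (C.x t) (C.y t) (C.z t) * C.face s e 1 (C.x t') (C.y t') (C.z t') <
    C.face s e 2 (C.x t') (C.y t') (C.z t') * C.face s e 1 (C.x t) (C.y t) (C.z t) := by
  have K := H.pin has heb
  have e1 : ∀ τ, C.face s e 1 (C.x τ) (C.y τ) (C.z τ) = _ := fun τ =>
    (face_pin s s e 1 _ _ _).symm.trans (K.face_eq e 1 _ _ _)
  have e2 : ∀ τ, C.face s e 2 (C.x τ) (C.y τ) (C.z τ) = _ := fun τ =>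
    (face_pin s s e 2 _ _ _).symm.trans (K.face_eq e 2 _ _ _)
  rw [e1, e1, e2, e2]
  exact K.chord_planes_lt h1 h2 h3

theorem face_two_critical {t t' : ℝ} (h1 : s < t) (h2 : t < t') (h3 : t' < e)
    (hz : C.phiAt s e * (C.m t - C.m s) - C.betaAt s e * C.lam s t = 0)
    (hz' : C.phiAt s e * (C.m t' - C.m s) - C.betaAt s e * C.lam s t' = 0) : False := by
  have e1 : ∀ t, (C.pin s).m t - (C.pin s).m s = C.m t - C.m s := fun t => by
    simp [ChebyshevCurve.pin]
  refine (H.pin has heb).face_two_critical h1 h2 h3.le ?_ ?_ <;>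
    rwa [phiAt_pin, betaAt_pin, lam_pin, e1]

theorem face_one_critical {t t' : ℝ} (h1 : s < t) (h2 : t < t') (h3 : t' < e)
    (hz : C.betaAt e s * C.lam e t - C.phiAt e s * (C.m t - C.m e) = 0)
    (hz' : C.betaAt e s * C.lam e t' - C.phiAt e s * (C.m t' - C.m e) = 0) : False := by
  refine H.reverse.face_two_critical (s := -e) (e := -s) (t := -t') (t' := -t) (by linarith)
      (by linarith) (by linarith) (by linarith) (by linarith) ?_ ?_ <;>
    simp only [phiAt_reverse, betaAt_reverse, lam_reverse] <;>
    simp only [ChebyshevCurve.reverse, neg_neg] <;> linarith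

end IsOn

end ChebyshevCurve

/-! ### Tetrahedra and affine functions -/

/-- The affine functions `F i` are, up to positive factors, the barycentric coordinates of the
tetrahedron `P`. -/
structure IsDualTo (F : Fin 4 → E3 →ᵃ[ℝ] ℝ) (P : Fin 4 → E3) : Prop where
  zero : ∀ {i j}, i ≠ j → F i (P j) = 0
  pos : ∀ i, 0 < F i (P i)

theorem AffineMap.map_combination {ι : Type*} [Fintype ι] (f : E3 →ᵃ[ℝ] ℝ) (w : ι → ℝ)
    (p : ι → E3) (hw : ∑ i, w i = 1) : f (∑ i, w i • p i) = ∑ i, w i * f (p i) := by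
  obtain ⟨c, h⟩ : ∃ c, ∀ v, f v = f.linear v + c := ⟨f 0, fun v => by
    have := f.map_vadd 0 v
    simpa using this⟩
  simp only [h, map_sum, map_smul, smul_eq_mul, mul_add, Finset.sum_add_distrib,
    ← Finset.sum_mul, hw, one_mul]

/-- An affine function vanishes on the affine span of a set on which it vanishes. -/
theorem AffineMap.eq_zero_of_mem_affineSpan {f : E3 →ᵃ[ℝ] ℝ} {s : Set E3} (h : ∀ p ∈ s, f p = 0)
    {p : E3} (hp : p ∈ affineSpan ℝ s) : f p = 0 := by
  refine affineSpan_induction (p := fun p => f p = 0) hp h fun c u v w hu hv hw => ?_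
  simp only [vsub_eq_sub, vadd_eq_add] at *
  have := f.map_vadd w (c • (u - v))
  have h2 : f.linear (u - v) = f u - f v := f.linearMap_vsub u v
  simp only [vadd_eq_add, map_smul, h2, hu, hv, hw, sub_self, smul_zero, zero_add] at this
  exact this

theorem mem_affineSpan_triple {A B D p : E3} {x y z : ℝ} (h : x + y + z = 1)
    (hp : x • A + y • B + z • D = p) : p ∈ affineSpan ℝ {A, B, D} := by
  have hA : A ∈ affineSpan ℝ {A, B, D} := subset_affineSpan _ _ (by simp)
  have hB : B ∈ affineSpan ℝ {A, B, D} := subset_affineSpan _ _ (by simp)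
  have hD : D ∈ affineSpan ℝ {A, B, D} := subset_affineSpan _ _ (by simp)
  have h1 := AffineSubspace.vsub_mem_direction hB hA
  have h2 := AffineSubspace.vsub_mem_direction hD hA
  have h3 := AffineSubspace.vadd_mem_of_mem_direction
    (Submodule.add_mem _ (Submodule.smul_mem _ y h1) (Submodule.smul_mem _ z h2)) hA
  convert h3 using 1
  obtain rfl : x = 1 - y - z := by linarith
  rw [← hp]
  simp only [vsub_eq_sub, vadd_eq_add]
  module

namespace IsDualTo

variable {F : Fin 4 → E3 →ᵃ[ℝ] ℝ} {P : Fin 4 → E3} (D : IsDualTo F P)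
include D

theorem comp {σ : Fin 4 → Fin 4} (hσ : Function.Injective σ) : IsDualTo (F ∘ σ) (P ∘ σ) :=
  ⟨fun h => D.zero (hσ.ne h), fun i => D.pos (σ i)⟩

theorem map_sum {w : Fin 4 → ℝ} (hw : ∑ i, w i = 1) (i : Fin 4) :
    F i (∑ j, w j • P j) = w i * F i (P i) := by
  rw [AffineMap.map_combination _ _ _ hw]
  refine Finset.sum_eq_single i (fun j _ hj => ?_) (by simp)
  rw [D.zero hj.symm, mul_zero]

theorem affineIndependent : AffineIndependent ℝ P := by
  rw [affineIndependent_iff_of_fintype]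
  intro w hw h i
  rw [Finset.weightedVSub_eq_weightedVSubOfPoint_of_sum_eq_zero _ w P hw (0 : E3)] at h
  simp only [Finset.weightedVSubOfPoint_apply, vsub_eq_sub, sub_zero] at h
  obtain ⟨c, hL⟩ : ∃ c, ∀ v, (F i).linear v = F i v - c := ⟨F i 0, fun v => by
    have := (F i).linearMap_vsub v 0
    simpa using this⟩
  have h2 := congrArg (F i).linear h
  rw [_root_.map_sum, map_zero,
    Finset.sum_congr rfl fun j _ => (F i).linear.map_smul (w j) (P j)] at h2
  simp only [hL, smul_eq_mul, mul_sub, Finset.sum_sub_distrib,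
    ← Finset.sum_mul, hw, zero_mul, sub_zero] at h2
  rw [Finset.sum_eq_single i (fun j _ hj => by rw [D.zero hj.symm, mul_zero]) (by simp)] at h2
  simpa [(D.pos i).ne'] using h2

/-- Barycentric coordinates. -/
theorem barycentric (p : E3) :
    ∑ i, F i p / F i (P i) = 1 ∧ ∑ i, (F i p / F i (P i)) • P i = p := by
  have htop : affineSpan ℝ (Set.range P) = ⊤ := by
    rw [D.affineIndependent.affineSpan_eq_top_iff_card_eq_finrank_add_one]
    simp
  let b : AffineBasis (Fin 4) ℝ E3 := ⟨P, D.affineIndependent, htop⟩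
  have hb : ∀ i, F i p / F i (P i) = b.coord i p := fun i => by
    rw [div_eq_iff (D.pos i).ne', ← D.map_sum (b.sum_coord_apply_eq_one p) i]
    exact congrArg (F i) (b.linear_combination_coord_eq_self p).symm
  simp only [hb]
  exact ⟨b.sum_coord_apply_eq_one p, b.linear_combination_coord_eq_self p⟩

theorem mem_solidTetrahedron {p : E3} (hp : ∀ i, 0 ≤ F i p) : p ∈ solidTetrahedron P := by
  obtain ⟨h1, h2⟩ := D.barycentric p
  rw [← h2]
  exact (convex_convexHull ℝ _).sum_mem (fun i _ => div_nonneg (hp i) (D.pos i).le) h1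
    fun i _ => subset_convexHull ℝ _ (mem_range_self i)

theorem mem_face_iff {p : E3} : p ∈ affineSpan ℝ {P 0, P 1, P 2} ↔ F 3 p = 0 := by
  refine ⟨fun h => AffineMap.eq_zero_of_mem_affineSpan ?_ h, fun h => ?_⟩
  · simp only [mem_insert_iff, mem_singleton_iff, forall_eq_or_imp, forall_eq]
    exact ⟨D.zero (by decide), D.zero (by decide), D.zero (by decide)⟩
  · obtain ⟨h1, h2⟩ := D.barycentric p
    rw [Fin.sum_univ_four, h, zero_div, add_zero] at h1
    rw [Fin.sum_univ_four, h, zero_div, zero_smul, add_zero] at h2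
    exact mem_affineSpan_triple h1 h2

/-- The plane through an edge of the tetrahedron and a further point. -/
theorem mem_edge_plane_iff {p R : E3} (hR : 0 < F 3 R) : p ∈ affineSpan ℝ {P 0, P 1, R} ↔
    (F 3 R • F 2 - F 2 R • F 3) p = 0 := by
  refine ⟨fun h => AffineMap.eq_zero_of_mem_affineSpan ?_ h, fun h => ?_⟩
  · have e1 := D.zero (i := 2) (j := 0) (by decide)
    have e2 := D.zero (i := 2) (j := 1) (by decide)
    have e3 := D.zero (i := 3) (j := 0) (by decide)
    have e4 := D.zero (i := 3) (j := 1) (by decide)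
    simp [e1, e2, e3, e4, mul_comm]
  · obtain ⟨h1, h2⟩ := D.barycentric p
    obtain ⟨h3, h4⟩ := D.barycentric R
    set c := F 3 p / F 3 R with hc
    have h5 : F 3 p = c * F 3 R := by rw [hc]; field_simp
    have h6 : F 2 p = c * F 2 R := by
      have : F 3 R * F 2 p - F 2 R * F 3 p = 0 := h
      rw [hc]; field_simp; linarith
    simp only [Fin.sum_univ_four, h5, h6, mul_div_assoc] at h1 h2 h3 h4
    refine mem_affineSpan_triple (x := F 0 p / F 0 (P 0) - c * (F 0 R / F 0 (P 0)))
      (y := F 1 p / F 1 (P 1) - c * (F 1 R / F 1 (P 1))) (z := c) ?_ ?_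
    · linear_combination h1 - c * h3
    · linear_combination (norm := module) h2 - c • h4

end IsDualTo

/-- A moving plane, given by affine functions, whose intersection with the line `A B` moves
monotonically. -/
theorem MovesMonotonically.of_affineMap {S : ℝ → AffineSubspace ℝ E3} {G : ℝ → E3 →ᵃ[ℝ] ℝ}
    {A B : E3} {a b : ℝ} (hS : ∀ t ∈ Ioo a b, ∀ p, p ∈ S t ↔ G t p = 0)
    (hA : ∀ t ∈ Ioo a b, G t A < 0) (hB : ∀ t ∈ Ioo a b, 0 < G t B)
    (hlt : ∀ t t', a < t → t < t' → t' < b → -G t A * G t' B < -G t' A * G t B) :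
    MovesMonotonically S A B a b := by
  have hG : ∀ t x, G t (AffineMap.lineMap A B x) = G t A + x * (G t B - G t A) := fun t x => by
    rw [AffineMap.apply_lineMap, AffineMap.lineMap_apply, vsub_eq_sub, vadd_eq_add, smul_eq_mul,
      add_comm]
  refine ⟨fun t => AffineMap.lineMap A B (-G t A / (G t B - G t A)), fun t ht => ⟨?_, ?_⟩, ?_⟩
  · have h1 := hA t ht
    have h2 := hB t ht
    have h3 : G t B - G t A ≠ 0 := by linarith
    ext p
    simp only [mem_inter_iff, SetLike.mem_coe, hS t ht, mem_singleton_iff,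
      mem_affineSpan_pair_iff_exists_lineMap_eq]
    constructor
    · rintro ⟨hp, x, rfl⟩
      rw [hG] at hp
      congr 1
      rw [eq_div_iff h3]; linarith
    · rintro rfl
      refine ⟨?_, _, rfl⟩
      rw [hG]; field_simp; ring
  · have h1 := hA t ht
    have h2 := hB t ht
    rw [openSegment_eq_image_lineMap]
    refine ⟨_, ⟨div_pos (by linarith) (by linarith), ?_⟩, rfl⟩
    rw [div_lt_one (by linarith)]; linarith
  · intro t ht t' ht' htt
    have h1 := hA t ht
    have h2 := hB t ht
    have h3 := hA t' ht'
    have h4 := hB t' ht'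
    have hAB : 0 < dist A B := dist_pos.2 (by rintro rfl; linarith)
    simp only [dist_left_lineMap]
    refine mul_lt_mul_of_pos_right ?_ hAB
    rw [Real.norm_of_nonneg (div_nonneg (by linarith) (by linarith)),
      Real.norm_of_nonneg (div_nonneg (by linarith) (by linarith)),
      div_lt_div_iff₀ (by linarith) (by linarith)]
    have := hlt t t' ht.1 htt ht'.2
    linarith

/-- A curve on one side of the plane `f = 0`, with ends on the plane, for which `f` has at most
one critical point. -/
theorem HasUniqueParallelPoint.of_affineMap {Q : AffineSubspace ℝ E3} {f : E3 →ᵃ[ℝ] ℝ}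
    {r : ℝ → E3} {a b : ℝ} (hab : a < b) (hQ : ∀ p, p ∈ Q ↔ f p = 0) (ha : f (r a) = 0)
    (hb : f (r b) = 0) (hpos : ∀ t ∈ Ioo a b, 0 < f (r t)) (hc : ContinuousOn r (Icc a b))
    (hd : ∀ t ∈ Ioo a b, DifferentiableAt ℝ r t)
    (huniq : ∀ t t', a < t → t < t' → t' < b → f.linear (deriv r t) = 0 →
      f.linear (deriv r t') ≠ 0) : HasUniqueParallelPoint r a b Q := by
  have haQ : r a ∈ Q := (hQ _).2 ha
  have hbQ : r b ∈ Q := (hQ _).2 hb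
  have hdir : ∀ v, v ∈ Q.direction ↔ f.linear v = 0 := fun v => by
    have h1 := f.map_vadd (r a) v
    rw [← AffineSubspace.vadd_mem_iff_mem_direction v haQ, hQ, h1, ha]
    simp
  have hside : ∀ s ∈ Ioo a b, ∀ s' ∈ Ioo a b, Q.SSameSide (r s) (r s') := by
    intro s hs s' hs'
    have h1 := hpos s hs
    have h2 := hpos s' hs'
    refine ⟨⟨r a, haQ, r s' - (f (r s') / f (r s)) • (r s - r a), ?_, ?_⟩, ?_, ?_⟩
    · rw [hQ]
      have h3 := f.map_vadd (r s') (-((f (r s') / f (r s)) • (r s - r a)))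
      have h4 : f.linear (r s - r a) = f (r s) - f (r a) := f.linearMap_vsub _ _
      rw [map_neg, map_smul, h4, ha, vadd_eq_add, neg_add_eq_sub] at h3
      rw [h3, vadd_eq_add, smul_eq_mul]
      field_simp
      ring
    · have : r s' -ᵥ (r s' - (f (r s') / f (r s)) • (r s - r a)) =
          (f (r s') / f (r s)) • (r s -ᵥ r a) := by simp
      rw [this]
      exact SameRay.sameRay_pos_smul_right _ (div_pos h2 h1)
    · rw [hQ]; exact h1.ne'
    · rw [hQ]; exact h2.ne'
  have hcf : ContinuousOn (fun t => f (r t)) (Icc a b) :=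
    f.continuous_of_finiteDimensional.comp_continuousOn hc
  obtain ⟨t, ht, hmax⟩ := isCompact_Icc.exists_isMaxOn (nonempty_Icc.2 hab.le) hcf
  have hmid : (a + b) / 2 ∈ Ioo a b := ⟨by linarith, by linarith⟩
  have hft : 0 < f (r t) := (hpos _ hmid).trans_le (hmax (Ioo_subset_Icc_self hmid))
  have htI : t ∈ Ioo a b := by
    refine ⟨lt_of_le_of_ne ht.1 ?_, lt_of_le_of_ne ht.2 ?_⟩
    · rintro rfl; linarith
    · rintro rfl; linarith
  have hderiv : ∀ u ∈ Ioo a b, HasDerivAt (fun t => f (r t)) (f.linear (deriv r u)) u := by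
    intro u hu
    have h1 := (LinearMap.toContinuousLinearMap f.linear).hasFDerivAt.comp_hasDerivAt u
      (hd u hu).hasDerivAt
    have h2 : (fun t => f (r t)) = fun t => f.linear (r t) + f 0 := by
      funext t
      have := f.map_vadd 0 (r t)
      simpa using this
    rw [h2]
    exact h1.add_const _
  have hcrit : f.linear (deriv r t) = 0 :=
    (hmax.isLocalMax (Icc_mem_nhds htI.1 htI.2)).hasDerivAt_eq_zero (hderiv t htI)
  refine ⟨t, ⟨⟨haQ, hbQ, hside⟩, ht, AffineSubspace.mk' (r t) Q.direction, ?_, ?_,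
    AffineSubspace.self_mem_mk' _ _, ?_⟩, ?_, ?_⟩
  · rw [AffineSubspace.parallel_iff_direction_eq_and_eq_bot_iff_eq_bot]
    refine ⟨AffineSubspace.direction_mk' _ _, ?_⟩
    have h1 : AffineSubspace.mk' (r t) Q.direction ≠ ⊥ := by
      rw [← AffineSubspace.nonempty_iff_ne_bot]
      exact ⟨r t, AffineSubspace.self_mem_mk' _ _⟩
    have h2 : Q ≠ ⊥ := by
      rw [← AffineSubspace.nonempty_iff_ne_bot]
      exact ⟨r a, haQ⟩
    simp [h1, h2]
  · intro h
    have : r t ∈ Q := h ▸ AffineSubspace.self_mem_mk' _ _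
    rw [hQ] at this
    linarith
  · rw [AffineSubspace.direction_mk', hdir]
    exact hcrit
  · rintro s ⟨-, hs, R, hR, hRQ, hsR, hsd⟩
    have hsQ : r s ∉ Q := fun h => hRQ
      (AffineSubspace.ext_of_direction_eq hR.direction_eq ⟨r s, hsR, h⟩)
    have hsI : s ∈ Ioo a b := by
      refine ⟨lt_of_le_of_ne hs.1 ?_, lt_of_le_of_ne hs.2 ?_⟩
      · rintro rfl; exact hsQ haQ
      · rintro rfl; exact hsQ hbQ
    rw [hR.direction_eq, hdir] at hsd
    rcases lt_trichotomy s t with h | h | h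
    · exact absurd hcrit (huniq s t hsI.1 h htI.2 hsd)
    · exact h
    · exact absurd hsd (huniq t s htI.1 h hsI.2 hcrit)
  · intro s hs
    refine (Metric.le_infDist ⟨r a, haQ⟩).2 fun y hy => ?_
    have hy0 : f y = 0 := (hQ y).1 hy
    have hs0 : 0 ≤ f (r s) := by
      rcases hs.1.eq_or_lt with rfl | h1
      · exact ha.ge
      · rcases hs.2.eq_or_lt with rfl | h2
        · exact hb.ge
        · exact (hpos s ⟨h1, h2⟩).le
    -- Scaling the segment from `r t` to the plane gives one from `r s` that is not longer.
    set c := f (r s) / f (r t) with hcdef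
    have hc0 : 0 ≤ c := div_nonneg hs0 hft.le
    have hc1 : c ≤ 1 := (div_le_one hft).2 (hmax hs)
    have hmem : r s - c • (r t - y) ∈ Q := by
      rw [hQ]
      have h3 := f.map_vadd (r s) (-(c • (r t - y)))
      have h4 : f.linear (r t - y) = f (r t) - f y := f.linearMap_vsub _ _
      rw [map_neg, map_smul, h4, hy0, vadd_eq_add, neg_add_eq_sub] at h3
      rw [h3, vadd_eq_add, smul_eq_mul, hcdef]
      field_simp
      ring
    refine (Metric.infDist_le_dist_of_mem hmem).trans ?_
    rw [dist_eq_norm, dist_eq_norm, sub_sub_cancel, norm_smul, Real.norm_of_nonneg hc0]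
    exact mul_le_of_le_one_left (norm_nonneg _) hc1

/-! ### Space curves in the position of a Chebyshev curve -/

theorem cross_smul_combination (a c d : ℝ) (B E : E3) :
    cross (a • B) (c • E + d • B) = (a * c) • cross B E := by
  ext i
  fin_cases i <;> simp [cross, crossProduct] <;> ring

theorem inner_cross_left (B E : E3) : inner ℝ (cross B E) B = 0 := by
  simp [cross, crossProduct, PiLp.inner_apply, Fin.sum_univ_three]
  ring

theorem inner_cross_right (B E : E3) : inner ℝ (cross B E) E = 0 := by
  simp [cross, crossProduct, PiLp.inner_apply, Fin.sum_univ_three]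
  ring

theorem inner_cross_shear (a b c : E3) (m l k : ℝ) :
    inner ℝ (cross (a + m • b + l • c) (b + k • c)) c = inner ℝ (cross a b) c := by
  simp [cross, crossProduct, PiLp.inner_apply, Fin.sum_univ_three]
  ring

theorem inner_cross_basis_ne_zero (f : Module.Basis (Fin 3) ℝ E3) :
    inner ℝ (cross (f 0) (f 1)) (f 2) ≠ 0 := by
  intro h
  have h0 : cross (f 0) (f 1) = 0 := by
    have h1 : innerₛₗ ℝ (cross (f 0) (f 1)) = 0 := by
      refine f.ext fun i => ?_
      fin_cases i
      · exact inner_cross_left _ _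
      · exact inner_cross_right _ _
      · exact h
    exact inner_self_eq_zero.1 (LinearMap.congr_fun h1 (cross (f 0) (f 1)))
  have h1 : crossProduct (f 0).ofLp (f 1).ofLp ≠ 0 := by
    rw [crossProduct_ne_zero_iff_linearIndependent]
    have h2 := f.linearIndependent.comp ![0, 1] (by decide)
    have h3 := h2.map' (WithLp.linearEquiv 2 ℝ (Fin 3 → ℝ)).toLinearMap (LinearEquiv.ker _)
    have h4 : ![(f 0).ofLp, (f 1).ofLp] =
        (WithLp.linearEquiv 2 ℝ (Fin 3 → ℝ)).toLinearMap ∘ f ∘ ![0, 1] := by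
      ext i j
      fin_cases i <;> rfl
    rw [h4]
    exact h3
  exact h1 (congrArg WithLp.ofLp h0)

theorem continuous_cross : Continuous fun p : E3 × E3 => cross p.1 p.2 := by
  unfold cross
  refine (PiLp.continuous_toLp 2 _).comp ?_
  refine continuous_pi fun i => ?_
  fin_cases i <;> simp [crossProduct] <;> fun_prop

theorem lineThrough_smul (p v : E3) {c : ℝ} (hc : c ≠ 0) :
    lineThrough p (c • v) = lineThrough p v := by
  rw [lineThrough, lineThrough, Submodule.span_singleton_smul_eq (IsUnit.mk0 c hc)]

theorem planeThrough_smul (p v : E3) {c : ℝ} (hc : c ≠ 0) :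
    planeThrough p (c • v) = planeThrough p v := by
  rw [planeThrough, planeThrough, Submodule.span_singleton_smul_eq (IsUnit.mk0 c hc)]

theorem mem_lineThrough {p v x : E3} : x ∈ lineThrough p v ↔ ∃ c : ℝ, p + c • v = x := by
  rw [lineThrough, AffineSubspace.mem_mk', Submodule.mem_span_singleton]
  simp only [vsub_eq_sub, eq_sub_iff_add_eq, add_comm]

theorem mem_planeThrough {p n x : E3} : x ∈ planeThrough p n ↔ inner ℝ n (x - p) = 0 := by
  rw [planeThrough, AffineSubspace.mem_mk', Submodule.mem_orthogonal_singleton_iff_inner_right,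
    vsub_eq_sub]

/-- In the basis `f`, the space curve `r` is the Chebyshev curve `C`. The differentiability
assumptions make curvature and torsion meaningful in the open interval. -/
structure Represents (f : Module.Basis (Fin 3) ℝ E3) (C : ChebyshevCurve) (r : ℝ → E3)
    (a b : ℝ) : Prop extends C.IsOn a b where
  eq : ∀ t, r t = C.x t • f 0 + C.y t • f 1 + C.z t • f 2
  ddx : ∀ t ∈ Ioo a b, DifferentiableAt ℝ C.dx t
  dddx : ∀ t ∈ Ioo a b, DifferentiableAt ℝ (deriv C.dx) t
  ddm : ∀ t ∈ Ioo a b, DifferentiableAt ℝ C.dm t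

namespace ChebyshevCurve

variable (C : ChebyshevCurve) (f : Module.Basis (Fin 3) ℝ E3)

/-- The tangent vector, normalised to have first coordinate `1`. -/
def tangent (t : ℝ) : E3 := f 0 + C.m t • f 1 + C.l t • f 2

/-- The derivative of `tangent` with respect to `m`. -/
def second (t : ℝ) : E3 := f 1 + C.k t • f 2

/-- A normal vector of the osculating plane. -/
def normal (t : ℝ) : E3 := cross (C.tangent f t) (C.second f t)

/-- The function `phi t` as an affine function on Euclidean space. -/
def phiMap (t : ℝ) : E3 →ᵃ[ℝ] ℝ :=
  (f.coord 2 - C.k t • f.coord 1 + (C.m t * C.k t - C.l t) • f.coord 0).toAffineMap -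
    AffineMap.const ℝ E3 (C.z t - C.k t * C.y t + (C.m t * C.k t - C.l t) * C.x t)

/-- The function `beta t` as an affine function on Euclidean space. -/
def betaMap (t : ℝ) : E3 →ᵃ[ℝ] ℝ :=
  (f.coord 1 - C.m t • f.coord 0).toAffineMap - AffineMap.const ℝ E3 (C.y t - C.m t * C.x t)

/-- The functions `face s e i` as affine functions on Euclidean space. -/
def faceMap (s e : ℝ) : Fin 4 → E3 →ᵃ[ℝ] ℝ :=
  ![-C.phiMap f e, C.betaAt e s • C.phiMap f e - C.phiAt e s • C.betaMap f e,
    C.phiAt s e • C.betaMap f s - C.betaAt s e • C.phiMap f s, C.phiMap f s]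

/-- The vertices of the control tetrahedron of `[s, e]`. -/
def vert (s e : ℝ) (i : Fin 4) : E3 :=
  C.vx s e i • f 0 + C.vy s e i • f 1 + C.vz s e i • f 2

theorem phiMap_apply (t X Y Z : ℝ) :
    C.phiMap f t (X • f 0 + Y • f 1 + Z • f 2) = C.phi t X Y Z := by
  simp [phiMap, phi]; ring

theorem betaMap_apply (t X Y Z : ℝ) :
    C.betaMap f t (X • f 0 + Y • f 1 + Z • f 2) = C.beta t X Y := by
  simp [betaMap, beta]; ring

theorem faceMap_apply (s e : ℝ) (i : Fin 4) (X Y Z : ℝ) :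
    C.faceMap f s e i (X • f 0 + Y • f 1 + Z • f 2) = C.face s e i X Y Z := by
  fin_cases i <;> simp [faceMap, face, phiMap_apply, betaMap_apply]

theorem phiMap_tangent (s t : ℝ) : (C.phiMap f s).linear (C.tangent f t) = C.lam s t := by
  simp [phiMap, tangent, lam]; ring

theorem betaMap_tangent (s t : ℝ) : (C.betaMap f s).linear (C.tangent f t) = C.m t - C.m s := by
  simp [betaMap, tangent]

end ChebyshevCurve

namespace Represents

variable {f : Module.Basis (Fin 3) ℝ E3} {C : ChebyshevCurve} {r : ℝ → E3} {a b : ℝ}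
  (H : Represents f C r a b)
include H

theorem hasDerivAt {t : ℝ} (ht : t ∈ Ioo a b) : HasDerivAt r (C.dx t • C.tangent f t) t := by
  have h := (((H.hx t ht).smul_const (f 0)).add ((H.hy t ht).smul_const (f 1))).add
    ((H.hz t ht).smul_const (f 2))
  rw [show r = fun t => C.x t • f 0 + C.y t • f 1 + C.z t • f 2 from funext H.eq]
  refine h.congr_deriv ?_
  rw [ChebyshevCurve.tangent]
  module

theorem hasDerivAt_tangent {t : ℝ} (ht : t ∈ Ioo a b) :
    HasDerivAt (C.tangent f) (C.dm t • C.second f t) t := by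
  have h := (((H.hm t ht).smul_const (f 1)).const_add (f 0)).add ((H.hl t ht).smul_const (f 2))
  refine h.congr_deriv ?_
  rw [ChebyshevCurve.second]
  module

theorem hasDerivAt_second {t : ℝ} (ht : t ∈ Ioo a b) :
    HasDerivAt (C.second f) (C.dk t • f 2) t :=
  ((H.hk t ht).smul_const (f 2)).const_add (f 1)

theorem deriv_eq {t : ℝ} (ht : t ∈ Ioo a b) : deriv r t = C.dx t • C.tangent f t :=
  (H.hasDerivAt ht).deriv

theorem iteratedDeriv_two {t : ℝ} (ht : t ∈ Ioo a b) : iteratedDeriv 2 r t =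
    (C.dx t * C.dm t) • C.second f t + deriv C.dx t • C.tangent f t := by
  rw [iteratedDeriv_succ, iteratedDeriv_one]
  have h : deriv r =ᶠ[𝓝 t] fun t => C.dx t • C.tangent f t := by
    filter_upwards [isOpen_Ioo.mem_nhds ht] with u hu using H.deriv_eq hu
  rw [h.deriv_eq]
  refine ((H.ddx t ht).hasDerivAt.smul (H.hasDerivAt_tangent ht)).deriv.trans ?_
  module

theorem iteratedDeriv_three {t : ℝ} (ht : t ∈ Ioo a b) : ∃ α β : ℝ, iteratedDeriv 3 r t =
    (C.dx t * C.dm t * C.dk t) • f 2 + α • C.second f t + β • C.tangent f t := by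
  rw [iteratedDeriv_succ]
  have h : iteratedDeriv 2 r =ᶠ[𝓝 t] fun t =>
      (C.dx t * C.dm t) • C.second f t + deriv C.dx t • C.tangent f t := by
    filter_upwards [isOpen_Ioo.mem_nhds ht] with u hu using H.iteratedDeriv_two hu
  have h1 := ((H.ddx t ht).hasDerivAt.mul (H.ddm t ht).hasDerivAt).smul (H.hasDerivAt_second ht)
  have h2 := (H.dddx t ht).hasDerivAt.smul (H.hasDerivAt_tangent ht)
  refine ⟨deriv C.dx t * C.dm t + C.dx t * deriv C.dm t + deriv C.dx t * C.dm t,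
    deriv (deriv C.dx) t, ?_⟩
  rw [h.deriv_eq]
  refine (h1.add h2).deriv.trans ?_
  simp only [Pi.mul_apply]
  module

omit H in
theorem inner_normal (t : ℝ) : inner ℝ (C.normal f t) (f 2) = inner ℝ (cross (f 0) (f 1)) (f 2) :=
  inner_cross_shear _ _ _ _ _ _

omit H in
theorem normal_ne_zero (t : ℝ) : C.normal f t ≠ 0 := by
  intro h
  have := inner_normal (f := f) (C := C) t
  rw [h, inner_zero_left] at this
  exact inner_cross_basis_ne_zero f this.symm

omit H in
theorem tangent_ne_zero (t : ℝ) : C.tangent f t ≠ 0 := by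
  intro h
  have := congrArg (f.coord 0) h
  simp [ChebyshevCurve.tangent] at this

theorem cross_eq {t : ℝ} (ht : t ∈ Ioo a b) : cross (deriv r t) (iteratedDeriv 2 r t) =
    (C.dx t * (C.dx t * C.dm t)) • C.normal f t := by
  rw [H.deriv_eq ht, H.iteratedDeriv_two ht, cross_smul_combination]
  rfl

theorem deriv_ne_zero {t : ℝ} (ht : t ∈ Ioo a b) : deriv r t ≠ 0 := by
  rw [H.deriv_eq ht]
  exact smul_ne_zero (H.px t ht).ne' (tangent_ne_zero t)

theorem cross_ne_zero {t : ℝ} (ht : t ∈ Ioo a b) :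
    cross (deriv r t) (iteratedDeriv 2 r t) ≠ 0 := by
  rw [H.cross_eq ht]
  have h1 := H.px t ht
  have h2 := H.pm t ht
  exact smul_ne_zero (by positivity) (normal_ne_zero t)

theorem curvature_ne_zero {t : ℝ} (ht : t ∈ Ioo a b) : curvature r t ≠ 0 :=
  div_ne_zero (norm_ne_zero_iff.2 (H.cross_ne_zero ht))
    (pow_ne_zero _ (norm_ne_zero_iff.2 (H.deriv_ne_zero ht)))

theorem torsion_ne_zero {t : ℝ} (ht : t ∈ Ioo a b) : torsion r t ≠ 0 := by
  refine div_ne_zero ?_ (pow_ne_zero _ (norm_ne_zero_iff.2 (H.cross_ne_zero ht)))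
  obtain ⟨α, β, h⟩ := H.iteratedDeriv_three ht
  rw [H.cross_eq ht, h, inner_smul_left, inner_add_right, inner_add_right, inner_smul_right,
    inner_smul_right, inner_smul_right, inner_normal, ChebyshevCurve.normal, inner_cross_left,
    inner_cross_right, mul_zero, mul_zero, add_zero, add_zero]
  have h1 := H.px t ht
  have h2 := H.pm t ht
  have h3 := H.pk t ht
  exact mul_ne_zero (by simp; exact ⟨h1.ne', h2.ne'⟩)
    (mul_ne_zero (by positivity) (inner_cross_basis_ne_zero f))

theorem unitTangent_eq {t : ℝ} (ht : t ∈ Ioo a b) :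
    unitTangent r t = ‖C.tangent f t‖⁻¹ • C.tangent f t := by
  have h1 := H.px t ht
  rw [unitTangent, H.deriv_eq ht, norm_smul, Real.norm_of_nonneg h1.le, smul_smul]
  congr 1
  field_simp

theorem binormal_eq {t : ℝ} (ht : t ∈ Ioo a b) :
    binormal r t = ‖C.normal f t‖⁻¹ • C.normal f t := by
  have h1 := H.px t ht
  have h2 := H.pm t ht
  rw [binormal, H.cross_eq ht, norm_smul, Real.norm_of_nonneg (by positivity), smul_smul]
  congr 1
  field_simp

theorem continuousOn_tangent : ContinuousOn (C.tangent f) (Icc a b) :=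
  ((H.cm.smul continuousOn_const).const_add _).add (H.cl.smul continuousOn_const)

theorem continuousOn_normal : ContinuousOn (C.normal f) (Icc a b) := by
  have h : ContinuousOn (C.second f) (Icc a b) := (H.ck.smul continuousOn_const).const_add _
  have h2 : C.normal f = fun t => cross (C.tangent f t) (C.second f t) := rfl
  rw [h2]
  exact Continuous.comp_continuousOn (g := fun p : E3 × E3 => cross p.1 p.2)
    (f := fun t => (C.tangent f t, C.second f t)) continuous_cross
    (H.continuousOn_tangent.prodMk h)

theorem continuousOn : ContinuousOn r (Icc a b) := by
  rw [show r = fun t => C.x t • f 0 + C.y t • f 1 + C.z t • f 2 from funext H.eq]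
  exact ((H.cx.smul continuousOn_const).add (H.cy.smul continuousOn_const)).add
    (H.cz.smul continuousOn_const)

omit H in
theorem tendsto_normalize {g : ℝ → E3} (hg : ContinuousOn g (Icc a b)) {s : ℝ} (hs : s ∈ Icc a b)
    (h0 : g s ≠ 0) : Tendsto (fun t => ‖g t‖⁻¹ • g t) (𝓝[Ioo a b] s) (𝓝 (‖g s‖⁻¹ • g s)) := by
  have h1 : Tendsto g (𝓝[Ioo a b] s) (𝓝 (g s)) :=
    (hg s hs).mono_left (nhdsWithin_mono s Ioo_subset_Icc_self)
  exact (h1.norm.inv₀ (norm_ne_zero_iff.2 h0)).smul h1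

theorem tendsto_unitTangent {s : ℝ} (hs : s ∈ Icc a b) : Tendsto (unitTangent r) (𝓝[Ioo a b] s)
    (𝓝 (‖C.tangent f s‖⁻¹ • C.tangent f s)) := by
  refine (tendsto_normalize H.continuousOn_tangent hs (tangent_ne_zero s)).congr' ?_
  filter_upwards [self_mem_nhdsWithin] with t ht using (H.unitTangent_eq ht).symm

theorem tendsto_binormal {s : ℝ} (hs : s ∈ Icc a b) : Tendsto (binormal r) (𝓝[Ioo a b] s)
    (𝓝 (‖C.normal f s‖⁻¹ • C.normal f s)) := by
  refine (tendsto_normalize H.continuousOn_normal hs (normal_ne_zero s)).congr' ?_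
  filter_upwards [self_mem_nhdsWithin] with t ht using (H.binormal_eq ht).symm

omit H in
theorem nhdsGT_le {s : ℝ} (hs : s ∈ Ico a b) : 𝓝[>] s ≤ 𝓝[Ioo a b] s := by
  rw [← nhdsWithin_Ioo_eq_nhdsGT hs.2]
  exact nhdsWithin_mono s (Ioo_subset_Ioo_left hs.1)

omit H in
theorem nhdsLT_le {s : ℝ} (hs : s ∈ Ioc a b) : 𝓝[<] s ≤ 𝓝[Ioo a b] s := by
  rw [← nhdsWithin_Ioo_eq_nhdsLT hs.1]
  exact nhdsWithin_mono s (Ioo_subset_Ioo_right hs.2)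

theorem isRightTangentLine {s : ℝ} (hs : s ∈ Ico a b) :
    IsRightTangentLine r s (lineThrough (r s) (C.tangent f s)) :=
  ⟨_, (H.tendsto_unitTangent ⟨hs.1, hs.2.le⟩).mono_left (nhdsGT_le hs),
    (lineThrough_smul _ _ (inv_ne_zero (norm_ne_zero_iff.2 (tangent_ne_zero s)))).symm⟩

theorem isLeftTangentLine {s : ℝ} (hs : s ∈ Ioc a b) :
    IsLeftTangentLine r s (lineThrough (r s) (C.tangent f s)) :=
  ⟨_, (H.tendsto_unitTangent ⟨hs.1.le, hs.2⟩).mono_left (nhdsLT_le hs),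
    (lineThrough_smul _ _ (inv_ne_zero (norm_ne_zero_iff.2 (tangent_ne_zero s)))).symm⟩

theorem isRightOsculatingPlane {s : ℝ} (hs : s ∈ Ico a b) :
    IsRightOsculatingPlane r s (planeThrough (r s) (C.normal f s)) :=
  ⟨_, (H.tendsto_binormal ⟨hs.1, hs.2.le⟩).mono_left (nhdsGT_le hs),
    (planeThrough_smul _ _ (inv_ne_zero (norm_ne_zero_iff.2 (normal_ne_zero s)))).symm⟩

theorem isLeftOsculatingPlane {s : ℝ} (hs : s ∈ Ioc a b) :
    IsLeftOsculatingPlane r s (planeThrough (r s) (C.normal f s)) :=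
  ⟨_, (H.tendsto_binormal ⟨hs.1.le, hs.2⟩).mono_left (nhdsLT_le hs),
    (planeThrough_smul _ _ (inv_ne_zero (norm_ne_zero_iff.2 (normal_ne_zero s)))).symm⟩

theorem osculatingPlane_eq {t : ℝ} (ht : t ∈ Ioo a b) :
    osculatingPlane r t = planeThrough (r t) (C.normal f t) := by
  rw [osculatingPlane, H.binormal_eq ht,
    planeThrough_smul _ _ (inv_ne_zero (norm_ne_zero_iff.2 (normal_ne_zero t)))]

theorem mem_osculating_iff (t : ℝ) (p : E3) :
    p ∈ planeThrough (r t) (C.normal f t) ↔ C.phiMap f t p = 0 := by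
  obtain ⟨X, Y, Z, rfl⟩ : ∃ X Y Z : ℝ, p = X • f 0 + Y • f 1 + Z • f 2 :=
    ⟨f.repr p 0, f.repr p 1, f.repr p 2, by
      rw [← Fin.sum_univ_three fun i => f.repr p i • f i, f.sum_repr]⟩
  have h : X • f 0 + Y • f 1 + Z • f 2 - r t = (X - C.x t) • C.tangent f t +
      C.beta t X Y • C.second f t + C.phi t X Y Z • f 2 := by
    rw [H.eq, ChebyshevCurve.tangent, ChebyshevCurve.second, ChebyshevCurve.beta,
      ChebyshevCurve.phi]
    module
  rw [mem_planeThrough, C.phiMap_apply, h, inner_add_right, inner_add_right, inner_smul_right,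
    inner_smul_right, inner_smul_right, inner_normal, ChebyshevCurve.normal, inner_cross_left,
    inner_cross_right, mul_zero, mul_zero, zero_add, zero_add, mul_eq_zero,
    or_iff_left (inner_cross_basis_ne_zero f)]

/-! #### The control tetrahedron -/

variable {s e : ℝ}

theorem vert_zero : C.vert f s e 0 = r s := by
  rw [H.eq]; simp [ChebyshevCurve.vert, ChebyshevCurve.vx, ChebyshevCurve.vy, ChebyshevCurve.vz]

theorem vert_three : C.vert f s e 3 = r e := by
  rw [H.eq]; simp [ChebyshevCurve.vert, ChebyshevCurve.vx, ChebyshevCurve.vy, ChebyshevCurve.vz]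

theorem vert_one : C.vert f s e 1 = r s + C.u s e • C.tangent f s := by
  rw [H.eq, ChebyshevCurve.tangent]
  simp [ChebyshevCurve.vert, ChebyshevCurve.vx, ChebyshevCurve.vy, ChebyshevCurve.vz]
  module

theorem vert_two : C.vert f s e 2 = r e - C.v s e • C.tangent f e := by
  rw [H.eq, ChebyshevCurve.tangent]
  simp [ChebyshevCurve.vert, ChebyshevCurve.vx, ChebyshevCurve.vy, ChebyshevCurve.vz]
  module

theorem faceMap_curve (t : ℝ) (i : Fin 4) :
    C.faceMap f s e i (r t) = C.face s e i (C.x t) (C.y t) (C.z t) := by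
  rw [H.eq, C.faceMap_apply]

variable (has : a ≤ s) (hse : s < e) (heb : e ≤ b)
include has hse heb

theorem isDualTo : IsDualTo (C.faceMap f s e) (C.vert f s e) where
  zero hij := by rw [ChebyshevCurve.vert, C.faceMap_apply, H.face_vert has heb hse hij]
  pos i := by
    rw [ChebyshevCurve.vert, C.faceMap_apply]
    exact H.face_vert_pos has heb hse i

theorem isAssociatedTetrahedron : IsAssociatedTetrahedron r s e (C.vert f s e) := by
  have D := H.isDualTo has hse heb
  have hs : s ∈ Ico a b := ⟨has, hse.trans_le heb⟩
  have he : e ∈ Ioc a b := ⟨has.trans_lt hse, heb⟩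
  have v1s : C.phiMap f s (C.vert f s e 1) = 0 := D.zero (i := 3) (j := 1) (by decide)
  have v2s : C.phiMap f s (C.vert f s e 2) = 0 := D.zero (i := 3) (j := 2) (by decide)
  have v1e : C.phiMap f e (C.vert f s e 1) = 0 :=
    neg_eq_zero.1 (D.zero (i := 0) (j := 1) (by decide))
  have v2e : C.phiMap f e (C.vert f s e 2) = 0 :=
    neg_eq_zero.1 (D.zero (i := 0) (j := 2) (by decide))
  have hl1 := (H.lam_pos' has hse heb).ne'
  have hl2 := (H.lam_pos has hse heb).ne'
  refine ⟨H.vert_zero, H.vert_three, D.affineIndependent, _, _, _, _, H.isRightTangentLine hs,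
    H.isLeftTangentLine he, H.isRightOsculatingPlane hs, H.isLeftOsculatingPlane he, ?_, ?_, ?_⟩
  · intro hpar
    have h1 : C.tangent f s ∈ (planeThrough (r s) (C.normal f s)).direction := by
      rw [planeThrough, AffineSubspace.direction_mk',
        Submodule.mem_orthogonal_singleton_iff_inner_right]
      exact inner_cross_left _ _
    rw [hpar.direction_eq, ← AffineSubspace.vadd_mem_iff_mem_direction _
      ((H.mem_osculating_iff e _).2 v1e), H.mem_osculating_iff, AffineMap.map_vadd, v1e,
      C.phiMap_tangent] at h1
    simp [hl1] at h1
  · ext p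
    simp only [mem_inter_iff, SetLike.mem_coe, H.mem_osculating_iff, mem_lineThrough,
      mem_singleton_iff]
    constructor
    · rintro ⟨⟨c, rfl⟩, -, h⟩
      have h2 : r s + c • C.tangent f s =
          ((c - C.u s e) • C.tangent f s) +ᵥ C.vert f s e 1 := by
        rw [H.vert_one, vadd_eq_add]; module
      rw [h2, AffineMap.map_vadd, v1e, map_smul, C.phiMap_tangent] at h
      have : c = C.u s e := by simpa [hl1, sub_eq_zero] using h
      rw [this, H.vert_one]
    · rintro rfl
      exact ⟨⟨_, H.vert_one.symm⟩, v1s, v1e⟩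
  · ext p
    simp only [mem_inter_iff, SetLike.mem_coe, H.mem_osculating_iff, mem_lineThrough,
      mem_singleton_iff]
    constructor
    · rintro ⟨⟨c, rfl⟩, h, -⟩
      have h2 : r e + c • C.tangent f e =
          ((c + C.v s e) • C.tangent f e) +ᵥ C.vert f s e 2 := by
        rw [H.vert_two, vadd_eq_add]; module
      rw [h2, AffineMap.map_vadd, v2s, map_smul, C.phiMap_tangent] at h
      have : c + C.v s e = 0 := by simpa [hl2] using h
      rw [H.vert_two, eq_neg_of_add_eq_zero_left this, neg_smul, sub_eq_add_neg]
    · rintro rfl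
      exact ⟨⟨-C.v s e, by rw [H.vert_two, neg_smul, sub_eq_add_neg]⟩, v2s, v2e⟩

theorem curve_mem_solidTetrahedron {t : ℝ} (ht : t ∈ Icc s e) :
    r t ∈ solidTetrahedron (C.vert f s e) := by
  rcases ht.1.eq_or_lt with rfl | h1
  · rw [← H.vert_zero (e := e)]
    exact subset_convexHull ℝ _ (mem_range_self 0)
  rcases ht.2.eq_or_lt with rfl | h2
  · rw [← H.vert_three (s := s)]
    exact subset_convexHull ℝ _ (mem_range_self 3)
  refine (H.isDualTo has hse heb).mem_solidTetrahedron fun i => ?_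
  rw [H.faceMap_curve]
  exact (H.face_curve_pos has heb h1 h2 i).le

theorem solidTetrahedron_left {τ : ℝ} (h1 : s < τ) (h2 : τ ≤ e) :
    solidTetrahedron (C.vert f s τ) ⊆ solidTetrahedron (C.vert f s e) := by
  have D := H.isDualTo has hse heb
  refine convexHull_min ?_ (convex_convexHull ℝ _)
  rintro _ ⟨j, rfl⟩
  have hj : ∀ j, j = 1 ∨ j = 2 → C.vert f s τ j ∈ solidTetrahedron (C.vert f s e) :=
    fun j hj => D.mem_solidTetrahedron fun i => by
      rw [ChebyshevCurve.vert, C.faceMap_apply]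
      exact H.face_left has heb h1 h2 i j hj
  fin_cases j
  · change C.vert f s τ 0 ∈ _
    rw [H.vert_zero]
    exact H.curve_mem_solidTetrahedron has hse heb ⟨le_rfl, hse.le⟩
  · exact hj 1 (Or.inl rfl)
  · exact hj 2 (Or.inr rfl)
  · change C.vert f s τ 3 ∈ _
    rw [H.vert_three]
    exact H.curve_mem_solidTetrahedron has hse heb ⟨h1.le, h2⟩

theorem solidTetrahedron_right {σ : ℝ} (h1 : s ≤ σ) (h2 : σ < e) :
    solidTetrahedron (C.vert f σ e) ⊆ solidTetrahedron (C.vert f s e) := by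
  have D := H.isDualTo has hse heb
  refine convexHull_min ?_ (convex_convexHull ℝ _)
  rintro _ ⟨j, rfl⟩
  have hj : ∀ j, j = 1 ∨ j = 2 → C.vert f σ e j ∈ solidTetrahedron (C.vert f s e) :=
    fun j hj => D.mem_solidTetrahedron fun i => by
      rw [ChebyshevCurve.vert, C.faceMap_apply]
      exact H.face_right has heb h1 h2 i j hj
  fin_cases j
  · change C.vert f σ e 0 ∈ _
    rw [H.vert_zero]
    exact H.curve_mem_solidTetrahedron has hse heb ⟨h1, h2.le⟩
  · exact hj 1 (Or.inl rfl)
  · exact hj 2 (Or.inr rfl)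
  · change C.vert f σ e 3 ∈ _
    rw [H.vert_three]
    exact H.curve_mem_solidTetrahedron has hse heb ⟨hse.le, le_rfl⟩

end Represents

/-! ### The cubic properties -/

theorem affineSpan_pair_eq_lineThrough (p v : E3) {c : ℝ} (hc : c ≠ 0) :
    affineSpan ℝ {p, p + c • v} = lineThrough p v := by
  ext x
  rw [mem_lineThrough, mem_affineSpan_pair_iff_exists_lineMap_eq]
  constructor
  · rintro ⟨y, rfl⟩
    exact ⟨y * c, by simp [AffineMap.lineMap_apply, mul_smul, add_comm]⟩
  · rintro ⟨y, rfl⟩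
    exact ⟨y / c, by simp [AffineMap.lineMap_apply, smul_smul, hc, add_comm]⟩

/-- Motion of the plane through `P 0`, `P 1` and a moving point along the opposite edge. -/
theorem IsDualTo.movesMonotonically {F : Fin 4 → E3 →ᵃ[ℝ] ℝ} {P : Fin 4 → E3} (D : IsDualTo F P)
    {R : ℝ → E3} {a b : ℝ} (h2 : ∀ t ∈ Ioo a b, 0 < F 2 (R t)) (h3 : ∀ t ∈ Ioo a b, 0 < F 3 (R t))
    (hlt : ∀ t t', a < t → t < t' → t' < b → F 2 (R t) * F 3 (R t') < F 2 (R t') * F 3 (R t)) :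
    MovesMonotonically (fun t => affineSpan ℝ {P 0, P 1, R t}) (P 3) (P 2) a b := by
  have e1 : F 2 (P 3) = 0 := D.zero (by decide)
  have e2 : F 3 (P 2) = 0 := D.zero (by decide)
  have p2 := D.pos 2
  have p3 := D.pos 3
  have g3 : ∀ t, (F 3 (R t) • F 2 - F 2 (R t) • F 3) (P 3) = -(F 2 (R t) * F 3 (P 3)) :=
    fun t => by simp [e1]
  have g2 : ∀ t, (F 3 (R t) • F 2 - F 2 (R t) • F 3) (P 2) = F 3 (R t) * F 2 (P 2) :=
    fun t => by simp [e2]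
  refine MovesMonotonically.of_affineMap (G := fun t => F 3 (R t) • F 2 - F 2 (R t) • F 3)
    (fun t ht p => D.mem_edge_plane_iff (h3 t ht)) (fun t ht => ?_) (fun t ht => ?_)
    fun t t' ht htt ht' => ?_
  · rw [g3]; exact neg_neg_of_pos (mul_pos (h2 t ht) p3)
  · rw [g2]; exact mul_pos (h3 t ht) p2
  · rw [g3, g2, g3, g2, neg_neg, neg_neg, mul_mul_mul_comm, mul_mul_mul_comm (F 2 (R t'))]
    exact mul_lt_mul_of_pos_right (hlt t t' ht htt ht') (mul_pos p3 p2)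

namespace Represents

variable {f : Module.Basis (Fin 3) ℝ E3} {C : ChebyshevCurve} {r : ℝ → E3} {a b : ℝ}
  (H : Represents f C r a b) {s e : ℝ}
include H

theorem osculating_monotone (has : a ≤ s) (heb : e ≤ b) :
    MovesMonotonically (osculatingPlane r) (C.vert f s e 0) (C.vert f s e 1) s e ∧
    MovesMonotonically (osculatingPlane r) (C.vert f s e 1) (C.vert f s e 2) s e ∧
    MovesMonotonically (osculatingPlane r) (C.vert f s e 2) (C.vert f s e 3) s e := by
  have hO : ∀ t ∈ Ioo s e, ∀ p, p ∈ osculatingPlane r t ↔ C.phiMap f t p = 0 :=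
    fun t ht p => by
      rw [H.osculatingPlane_eq ⟨has.trans_lt ht.1, ht.2.trans_le heb⟩, H.mem_osculating_iff]
  have hv : ∀ t i, C.phiMap f t (C.vert f s e i) =
      C.phi t (C.vx s e i) (C.vy s e i) (C.vz s e i) := fun t i => C.phiMap_apply f _ _ _ _
  have p0 : ∀ t ∈ Ioo s e, C.phiMap f t (C.vert f s e 0) < 0 := fun t ht => by
    rw [hv]; exact H.phiAt_neg has ht.1 (ht.2.le.trans heb)
  have p1 : ∀ t ∈ Ioo s e, 0 < C.phiMap f t (C.vert f s e 1) := fun t ht => by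
    rw [hv]; exact H.phi_vert_one_pos has heb ht.1 ht.2
  have p2 : ∀ t ∈ Ioo s e, C.phiMap f t (C.vert f s e 2) < 0 := fun t ht => by
    rw [hv]; exact H.phi_vert_two_neg has heb ht.1 ht.2
  have p3 : ∀ t ∈ Ioo s e, 0 < C.phiMap f t (C.vert f s e 3) := fun t ht => by
    rw [hv]; exact H.phiAt_pos (has.trans ht.1.le) ht.2 heb
  refine ⟨.of_affineMap hO p0 p1 fun t t' h1 h2 h3 => ?_,
    .of_affineMap (G := fun t => -C.phiMap f t) (fun t ht p => (hO t ht p).trans neg_eq_zero.symm)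
      (fun t ht => neg_neg_of_pos (p1 t ht)) (fun t ht => neg_pos.2 (p2 t ht))
      fun t t' h1 h2 h3 => ?_,
    .of_affineMap hO p2 p3 fun t t' h1 h2 h3 => ?_⟩
  · simp only [hv]
    exact H.osc_edge₀₁ has heb h1 h2 h3
  · simp only [AffineMap.coe_neg, Pi.neg_apply, hv, neg_neg]
    exact H.osc_edge₁₂ has heb h1 h2 h3
  · simp only [hv]
    exact H.osc_edge₂₃ has heb h1 h2 h3

variable (has : a ≤ s) (hse : s < e) (heb : e ≤ b)
include has hse heb

theorem affineSpan_eq_osculating_start : affineSpan ℝ {C.vert f s e 0, C.vert f s e 1,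
    C.vert f s e 2} = planeThrough (r s) (C.normal f s) := by
  ext p
  rw [(H.isDualTo has hse heb).mem_face_iff, H.mem_osculating_iff]
  rfl

theorem affineSpan_eq_osculating_end : affineSpan ℝ {C.vert f s e 1, C.vert f s e 2,
    C.vert f s e 3} = planeThrough (r e) (C.normal f e) := by
  ext p
  rw [H.mem_osculating_iff]
  refine ((H.isDualTo has hse heb).comp (σ := ![1, 2, 3, 0]) (by decide)).mem_face_iff.trans ?_
  exact neg_eq_zero

theorem edge_monotone :
    MovesMonotonically (fun t => affineSpan ℝ {C.vert f s e 1, C.vert f s e 2, r t})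
      (C.vert f s e 0) (C.vert f s e 3) s e ∧
    MovesMonotonically (fun t => affineSpan ℝ {C.vert f s e 0, C.vert f s e 3, r t})
      (C.vert f s e 1) (C.vert f s e 2) s e := by
  have D := H.isDualTo has hse heb
  have hp : ∀ i, ∀ t ∈ Ioo s e, 0 < C.faceMap f s e i (r t) := fun i t ht => by
    rw [H.faceMap_curve]; exact H.face_curve_pos has heb ht.1 ht.2 i
  refine ⟨(D.comp (σ := ![1, 2, 3, 0]) (by decide)).movesMonotonically (hp 3) (hp 0)
    fun t t' h1 h2 h3 => ?_, (D.comp (σ := ![0, 3, 2, 1]) (by decide)).movesMonotonically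
    (hp 2) (hp 1) fun t t' h1 h2 h3 => ?_⟩
  · have := H.face_edge₀₃ has heb h1 h2 h3
    simp only [← H.faceMap_curve] at this
    exact this
  · have := H.face_edge₁₂ has heb h1 h2 h3
    simp only [← H.faceMap_curve] at this
    exact this

theorem parallel_points :
    HasUniqueParallelPoint r s e
      (affineSpan ℝ {C.vert f s e 0, C.vert f s e 2, C.vert f s e 3}) ∧
    HasUniqueParallelPoint r s e
      (affineSpan ℝ {C.vert f s e 0, C.vert f s e 1, C.vert f s e 3}) := by
  have D := H.isDualTo has hse heb
  have hI : ∀ t, s < t → t < e → t ∈ Ioo a b := fun t h1 h2 => ⟨has.trans_lt h1, h2.trans_le heb⟩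
  have hc : ContinuousOn r (Icc s e) := H.continuousOn.mono (Icc_subset_Icc has heb)
  have hd : ∀ t ∈ Ioo s e, DifferentiableAt ℝ r t := fun t ht =>
    (H.hasDerivAt (hI t ht.1 ht.2)).differentiableAt
  have hs : ∀ i, i ≠ 0 → C.faceMap f s e i (r s) = 0 := fun i hi => by
    rw [← H.vert_zero (e := e)]; exact D.zero hi
  have he : ∀ i, i ≠ 3 → C.faceMap f s e i (r e) = 0 := fun i hi => by
    rw [← H.vert_three (s := s)]; exact D.zero hi
  have hp : ∀ i, ∀ t ∈ Ioo s e, 0 < C.faceMap f s e i (r t) := fun i t ht => by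
    rw [H.faceMap_curve]; exact H.face_curve_pos has heb ht.1 ht.2 i
  have hdx : ∀ i t, s < t → t < e → (C.faceMap f s e i).linear (deriv r t) = 0 →
      (C.faceMap f s e i).linear (C.tangent f t) = 0 := fun i t h1 h2 h => by
    rw [H.deriv_eq (hI t h1 h2), map_smul] at h
    exact (smul_eq_zero.1 h).resolve_left (H.px t (hI t h1 h2)).ne'
  have t1 : ∀ t, (C.faceMap f s e 1).linear (C.tangent f t) =
      C.betaAt e s * C.lam e t - C.phiAt e s * (C.m t - C.m e) := fun t => by
    rw [← C.phiMap_tangent f, ← C.betaMap_tangent f]; rfl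
  have t2 : ∀ t, (C.faceMap f s e 2).linear (C.tangent f t) =
      C.phiAt s e * (C.m t - C.m s) - C.betaAt s e * C.lam s t := fun t => by
    rw [← C.phiMap_tangent f, ← C.betaMap_tangent f]; rfl
  refine ⟨.of_affineMap hse
    (fun p => (D.comp (σ := ![0, 2, 3, 1]) (by decide)).mem_face_iff) (hs 1 (by decide))
    (he 1 (by decide)) (hp 1) hc hd fun t t' h1 h2 h3 hz hz' => ?_, .of_affineMap hse
    (fun p => (D.comp (σ := ![0, 1, 3, 2]) (by decide)).mem_face_iff) (hs 2 (by decide))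
    (he 2 (by decide)) (hp 2) hc hd fun t t' h1 h2 h3 hz hz' => ?_⟩
  · have hz := hdx 1 t h1 (h2.trans h3) hz
    have hz' := hdx 1 t' (h1.trans h2) h3 hz'
    rw [t1] at hz hz'
    exact H.face_one_critical has heb h1 h2 h3 hz hz'
  · have hz := hdx 2 t h1 (h2.trans h3) hz
    have hz' := hdx 2 t' (h1.trans h2) h3 hz'
    rw [t2] at hz hz'
    exact H.face_two_critical has heb h1 h2 h3 hz hz'

end Represents

/-- A rational curve which is a Chebyshev curve to the right of `a` is quasi-cubic on `[a, e]`,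
provided that no point after `a` is a multiple point. -/
theorem Represents.isQuasiCubic {K : Type*} [Field K] [Algebra K ℝ] {c : Fin 3 → RatFunc K}
    {f : Module.Basis (Fin 3) ℝ E3} {C : ChebyshevCurve} {a b e : ℝ}
    (H : Represents f C (RatCurve.point c) a b) (hae : a < e) (heb : e < b)
    (hdef : ∀ t ∈ Icc a e, RatCurve.DefinedAt c t)
    (hsing : ∀ t ∈ Ioc a e, ∀ s, s ≠ t → RatCurve.DefinedAt c s →
      RatCurve.point c s ≠ RatCurve.point c t) : IsQuasiCubic c a e := by
  have ha : a ∈ Ico a b := ⟨le_rfl, hae.trans heb⟩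
  have he : e ∈ Ioc a b := ⟨hae, heb.le⟩
  refine ⟨C.vert f a e, H.isAssociatedTetrahedron le_rfl hae heb.le, ?_⟩
  constructor
  · refine ⟨H.vert_zero, H.vert_three, ?_, ?_⟩
    · rw [H.vert_zero, H.vert_one,
        affineSpan_pair_eq_lineThrough _ _ (H.u_pos le_rfl hae heb.le).ne']
      exact H.isRightTangentLine ha
    · rw [H.vert_three, H.vert_two, Set.pair_comm, sub_eq_add_neg, ← neg_smul,
        affineSpan_pair_eq_lineThrough _ _ (neg_ne_zero.2 (H.v_pos le_rfl hae heb.le).ne')]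
      exact H.isLeftTangentLine he
  · rw [H.affineSpan_eq_osculating_start le_rfl hae heb.le,
      H.affineSpan_eq_osculating_end le_rfl hae heb.le]
    exact ⟨H.isRightOsculatingPlane ha, H.isLeftOsculatingPlane he⟩
  · exact fun t ht => H.curve_mem_solidTetrahedron le_rfl hae heb.le ht
  · refine ⟨fun t ht t' ht' h => ?_, fun t ht hchar => ?_⟩
    · rcases lt_trichotomy t t' with hlt | heq | hlt
      · exact absurd h (hsing t' ⟨ht.1.trans_lt hlt, ht'.2⟩ t hlt.ne (hdef t ht))
      · exact heq
      · exact absurd h.symm (hsing t ⟨ht'.1.trans_lt hlt, ht.2⟩ t' hlt.ne (hdef t' ht'))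
    · by_contra hne
      have hta : a < t := lt_of_le_of_ne ht.1 (Ne.symm hne)
      have htI : t ∈ Ioo a b := ⟨hta, ht.2.trans_lt heb⟩
      rcases hchar with (h | ⟨s, hs, hsd, h⟩) | h | h
      · exact H.deriv_ne_zero htI h
      · exact hsing t ⟨hta, ht.2⟩ s hs hsd h
      · exact H.curvature_ne_zero htI h
      · exact H.torsion_ne_zero htI h
  · intro a' b' ha' hab' hb'
    exact ⟨C.vert f a' b', H.isAssociatedTetrahedron ha' hab' (hb'.trans heb.le),
      (H.solidTetrahedron_left ha' (hab'.trans_le hb') heb.le hab' hb').trans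
        (H.solidTetrahedron_right le_rfl hae heb.le ha' (hab'.trans_le hb'))⟩
  · exact H.osculating_monotone le_rfl heb.le
  · exact H.edge_monotone le_rfl hae heb.le
  · exact H.parallel_points le_rfl hae heb.le

/-! ### Multiple points of a proper rational curve -/

namespace RatCurve

variable {K : Type*} [Field K] [Algebra K ℝ] {c : Fin 3 → RatFunc K}

/-- A polynomial in the coordinates of a rational curve is a quotient of polynomials in the
parameter whose denominator has no zero where the curve is defined. -/
theorem exists_fraction (c : Fin 3 → RatFunc K) (p : MvPolynomial (Fin 3) K) :
    ∃ n d : Polynomial K, d ≠ 0 ∧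
      MvPolynomial.aeval c p * algebraMap _ (RatFunc K) d = algebraMap _ (RatFunc K) n ∧
      ∀ t : ℝ, DefinedAt c t → Polynomial.aeval t d ≠ 0 ∧
        Polynomial.aeval t n = Polynomial.aeval t d * MvPolynomial.aeval (point c t).ofLp p := by
  induction p using MvPolynomial.induction_on with
  | C a =>
    refine ⟨Polynomial.C a, 1, one_ne_zero, ?_, fun t _ => ?_⟩
    · simp [RatFunc.algebraMap_eq_C]
    · simp
  | add p q hp hq =>
    obtain ⟨n₁, d₁, h₁, e₁, f₁⟩ := hp
    obtain ⟨n₂, d₂, h₂, e₂, f₂⟩ := hq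
    refine ⟨n₁ * d₂ + n₂ * d₁, d₁ * d₂, mul_ne_zero h₁ h₂, ?_, fun t ht => ?_⟩
    · simp only [map_add, map_mul, ← e₁, ← e₂]; ring
    · obtain ⟨a₁, b₁⟩ := f₁ t ht
      obtain ⟨a₂, b₂⟩ := f₂ t ht
      simp only [map_add, map_mul, b₁, b₂]
      exact ⟨mul_ne_zero a₁ a₂, by ring⟩
  | mul_X p i hp =>
    obtain ⟨n, d, h, e, f⟩ := hp
    refine ⟨n * (c i).num, d * (c i).denom, mul_ne_zero h (c i).denom_ne_zero, ?_,
      fun t ht => ?_⟩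
    · have h1 : algebraMap _ (RatFunc K) (c i).denom ≠ 0 := by
        simpa using (c i).denom_ne_zero
      have h2 : c i * algebraMap _ (RatFunc K) (c i).denom = algebraMap _ _ (c i).num := by
        conv_lhs => rw [← RatFunc.num_div_denom (c i)]
        rw [RatFunc.num_div_denom, ← eq_div_iff h1, RatFunc.num_div_denom]
      simp only [map_mul, MvPolynomial.aeval_X, ← e, ← h2]
      ring
    · obtain ⟨a, b⟩ := f t ht
      have hi := ht i
      simp only [map_mul, b, MvPolynomial.aeval_X, point]
      exact ⟨mul_ne_zero a hi, by field_simp⟩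

/-- On a proper curve the parameter is a rational function of the point, so that only finitely
many parameters can belong to multiple points. -/
theorem finite_multiple_points (h : IsProper c) : ∃ S : Set ℝ, S.Finite ∧ ∀ t ∉ S,
    DefinedAt c t → ∀ s, s ≠ t → DefinedAt c s → point c s ≠ point c t := by
  have hX : (RatFunc.X : RatFunc K) ∈ IntermediateField.adjoin K (Set.range c) := by
    rw [h]; exact IntermediateField.mem_top
  obtain ⟨A, B, hAB⟩ := (IntermediateField.mem_adjoin_range_iff K c _).1 hX
  have hB : MvPolynomial.aeval c B ≠ 0 := fun h0 => by
    rw [h0, div_zero] at hAB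
    exact RatFunc.X_ne_zero hAB
  rw [eq_div_iff hB] at hAB
  obtain ⟨nA, dA, hdA, eA, fA⟩ := exists_fraction c A
  obtain ⟨nB, dB, hdB, eB, fB⟩ := exists_fraction c B
  have hdB' : algebraMap _ (RatFunc K) dB ≠ 0 := by simpa using hdB
  have hnB : nB ≠ 0 := by
    rintro rfl
    rw [map_zero] at eB
    exact mul_ne_zero hB hdB' eB
  have hpoly : Polynomial.X * nB * dA = nA * dB := by
    apply RatFunc.algebraMap_injective K
    rw [map_mul, map_mul, map_mul, ← eA, ← eB, RatFunc.algebraMap_X, ← hAB]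
    ring
  have key : ∀ t, DefinedAt c t → t * MvPolynomial.aeval (point c t).ofLp B =
      MvPolynomial.aeval (point c t).ofLp A := fun t ht => by
    obtain ⟨a₁, b₁⟩ := fA t ht
    obtain ⟨a₂, b₂⟩ := fB t ht
    have h1 := congrArg (Polynomial.aeval t) hpoly
    simp only [map_mul, Polynomial.aeval_X, b₁, b₂] at h1
    refine mul_left_cancel₀ (mul_ne_zero a₁ a₂) ?_
    linear_combination h1
  refine ⟨nB.rootSet ℝ, nB.rootSet_finite ℝ, fun t htS ht s hst hs heq => hst ?_⟩
  have h1 := key t ht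
  have h2 := key s hs
  rw [heq, ← h1] at h2
  refine mul_right_cancel₀ (fun h0 => htS ?_) h2
  rw [Polynomial.mem_rootSet]
  refine ⟨hnB, ?_⟩
  rw [(fB t ht).2, h0, mul_zero]

theorem analyticAt_point {t : ℝ} (ht : DefinedAt c t) : AnalyticAt ℝ (point c) t := by
  have h1 : AnalyticAt ℝ (fun (t : ℝ) (i : Fin 3) =>
      Polynomial.aeval t (c i).num / Polynomial.aeval t (c i).denom) t := by
    rw [analyticAt_pi_iff]
    intro i
    exact (analyticAt_id.aeval_polynomial _).div (analyticAt_id.aeval_polynomial _) (ht i)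
  exact ((PiLp.continuousLinearEquiv 2 ℝ fun _ : Fin 3 => ℝ).symm.toContinuousLinearMap.analyticAt
    _).comp h1

end RatCurve

/-! ### Adapted frames of analytic curves -/

theorem AnalyticAt.eventually_const_of_deriv {F : Type*} [NormedAddCommGroup F] [NormedSpace ℝ F]
    [CompleteSpace F] {g : ℝ → F} {t₀ : ℝ} (hg : AnalyticAt ℝ g t₀)
    (h : ∀ᶠ t in 𝓝 t₀, deriv g t = 0) : ∀ᶠ t in 𝓝 t₀, g t = g t₀ := by
  obtain ⟨ε, hε, hball⟩ := Metric.eventually_nhds_iff_ball.1 (h.and hg.eventually_analyticAt)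
  filter_upwards [Metric.ball_mem_nhds t₀ hε] with t ht
  exact Metric.isOpen_ball.is_const_of_deriv_eq_zero (convex_ball t₀ ε).isPreconnected
    (fun u hu => (hball u hu).2.differentiableAt.differentiableWithinAt)
    (fun u hu => (hball u hu).1) ht (Metric.mem_ball_self hε)

/-- An analytic vector function is a scalar function, positive to the right of `t₀`, times an
analytic vector function that does not vanish and lies in an affine plane off the origin. -/
theorem AnalyticAt.exists_eq_smul {g : ℝ → E3} {t₀ : ℝ} (hg : AnalyticAt ℝ g t₀)
    (hne : ¬∀ᶠ t in 𝓝 t₀, g t = 0) : ∃ (d : ℝ → ℝ) (B : ℝ → E3) (φ : E3 →L[ℝ] ℝ),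
      AnalyticAt ℝ d t₀ ∧ AnalyticAt ℝ B t₀ ∧ (∀ᶠ t in 𝓝 t₀, g t = d t • B t) ∧
      (∀ᶠ t in 𝓝 t₀, φ (B t) = 1) ∧ (∀ᶠ t in 𝓝[>] t₀, 0 < d t) ∧
      ∀ ψ : E3 →L[ℝ] ℝ, (∀ᶠ t in 𝓝 t₀, ψ (g t) = 0) → ∀ᶠ t in 𝓝 t₀, ψ (B t) = 0 := by
  obtain ⟨n, A, hA, hA0, hgA⟩ := hg.exists_eventuallyEq_pow_smul_nonzero_iff.2 hne
  let φ : E3 →L[ℝ] ℝ := innerSL ℝ (A t₀)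
  have hφ0 : 0 < φ (A t₀) := real_inner_self_pos.2 hA0
  have hφA : AnalyticAt ℝ (fun t => φ (A t)) t₀ := (φ.analyticAt _).comp hA
  have hpos : ∀ᶠ t in 𝓝 t₀, 0 < φ (A t) := hφA.continuousAt.eventually (lt_mem_nhds hφ0)
  have hB : AnalyticAt ℝ (fun t => (φ (A t))⁻¹ • A t) t₀ := (hφA.inv hφ0.ne').smul hA
  have hd : AnalyticAt ℝ (fun t => (t - t₀) ^ n * φ (A t)) t₀ :=
    ((analyticAt_id.sub analyticAt_const).pow n).mul hφA
  have hgB : ∀ᶠ t in 𝓝 t₀, g t = ((t - t₀) ^ n * φ (A t)) • (φ (A t))⁻¹ • A t := by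
    filter_upwards [hgA, hpos] with t h1 h2
    rw [h1, smul_smul, mul_assoc, mul_inv_cancel₀ h2.ne', mul_one]
  refine ⟨_, _, φ, hd, hB, hgB, ?_, ?_, fun ψ hψ => ?_⟩
  · filter_upwards [hpos] with t ht
    rw [map_smul, smul_eq_mul, inv_mul_cancel₀ ht.ne']
  · filter_upwards [hpos.filter_mono nhdsWithin_le_nhds, self_mem_nhdsWithin] with t h1 h2
    exact mul_pos (pow_pos (sub_pos.2 h2) n) h1
  · refine (((ψ.analyticAt _).comp hB).eventually_eq_zero_or_eventually_ne_zero).resolve_right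
      fun hcon => ?_
    have : ∀ᶠ _t in 𝓝[≠] t₀, False := by
      filter_upwards [hcon, hψ.filter_mono nhdsWithin_le_nhds,
        hgB.filter_mono nhdsWithin_le_nhds, hpos.filter_mono nhdsWithin_le_nhds,
        self_mem_nhdsWithin] with t h1 h2 h3 h4 h5
      rw [h3, map_smul, smul_eq_mul] at h2
      exact h1 ((mul_eq_zero.1 h2).resolve_left
        (mul_ne_zero (pow_ne_zero _ (sub_ne_zero.2 h5)) h4.ne'))
    obtain ⟨_, hf⟩ := this.exists
    exact hf

theorem exists_functional_eq_zero (u v : E3) : ∃ ψ : E3 →L[ℝ] ℝ, ψ ≠ 0 ∧ ψ u = 0 ∧ ψ v = 0 := by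
  have h1 : Module.finrank ℝ (Submodule.span ℝ {u, v}) ≤ 2 := by
    classical
    have h := finrank_span_finset_le_card (R := ℝ) ({u, v} : Finset E3)
    rw [Finset.coe_pair] at h
    exact h.trans Finset.card_le_two
  have h2 := Submodule.finrank_add_finrank_orthogonal (Submodule.span ℝ {u, v})
  have h3 : (Submodule.span ℝ {u, v})ᗮ ≠ ⊥ := by
    intro h
    rw [h, finrank_bot, finrank_euclideanSpace_fin] at h2
    omega
  obtain ⟨n, hn, hn0⟩ := Submodule.exists_mem_ne_zero_of_ne_bot h3
  refine ⟨innerSL ℝ n, ?_, ?_, ?_⟩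
  · intro h
    have := congrArg (fun L : E3 →L[ℝ] ℝ => L n) h
    exact hn0 (inner_self_eq_zero.1 this)
  · exact Submodule.inner_left_of_mem_orthogonal (Submodule.subset_span (by simp)) hn
  · exact Submodule.inner_left_of_mem_orthogonal (Submodule.subset_span (by simp)) hn


/-- Unless the curve is planar, peeling off the vanishing orders of successive derivatives gives
vectors `B`, `E`, `G` with `r' = d₁ B`, `B' = d₂ E`, `E' = d₃ G` and positive `d₁`, `d₂`, `d₃` to
the right of `t₀`. In the basis `B t₀`, `E t₀`, `G t₀` the curve is a Chebyshev curve. -/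
theorem AnalyticAt.exists_represents {r : ℝ → E3} {t₀ : ℝ} (hr : AnalyticAt ℝ r t₀)
    (hnp : ∀ ψ : E3 →L[ℝ] ℝ, ψ ≠ 0 → ¬∀ᶠ t in 𝓝 t₀, ψ (deriv r t) = 0) :
    ∃ (f : Module.Basis (Fin 3) ℝ E3) (C : ChebyshevCurve) (b : ℝ), t₀ < b ∧
      Represents f C r t₀ b := by
  have hderiv : ∀ {g : ℝ → E3} (ψ : E3 →L[ℝ] ℝ) {t : ℝ}, AnalyticAt ℝ g t →
      HasDerivAt (fun t => ψ (g t)) (ψ (deriv g t)) t := fun ψ t hg =>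
    ψ.hasFDerivAt.comp_hasDerivAt t hg.differentiableAt.hasDerivAt
  have hconst : ∀ {g : ℝ → E3} (ψ : E3 →L[ℝ] ℝ) (c : ℝ), AnalyticAt ℝ g t₀ →
      (∀ᶠ t in 𝓝 t₀, ψ (g t) = c) → ∀ᶠ t in 𝓝 t₀, ψ (deriv g t) = 0 := fun {g} ψ c hg h => by
    filter_upwards [h.eventually_nhds, hg.eventually_analyticAt] with t h1 h2
    rw [← (hderiv ψ h2).deriv, EventuallyEq.deriv_eq (f := fun _ => c) h1, deriv_const]
  have hg1 : ¬∀ᶠ t in 𝓝 t₀, deriv r t = 0 := fun h => by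
    obtain ⟨ψ, hψ, -, -⟩ := exists_functional_eq_zero 0 0
    exact hnp ψ hψ (h.mono fun t ht => by rw [ht, map_zero])
  obtain ⟨d₁, B, φ₁, ad₁, aB, hB, hφB, hd₁, hψB⟩ := hr.deriv.exists_eq_smul hg1
  have hplanar : ∀ ψ : E3 →L[ℝ] ℝ, ψ (B t₀) = 0 → (∀ᶠ t in 𝓝 t₀, ψ (deriv B t) = 0) → ψ = 0 := by
    intro ψ h0 h
    by_contra hψ
    refine hnp ψ hψ ?_
    have h1 : AnalyticAt ℝ (fun t => ψ (B t)) t₀ := (ψ.analyticAt _).comp aB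
    have h2 : ∀ᶠ t in 𝓝 t₀, deriv (fun t => ψ (B t)) t = 0 := by
      filter_upwards [h, aB.eventually_analyticAt] with t h1 h2
      rw [(hderiv ψ h2).deriv, h1]
    filter_upwards [hB, h1.eventually_const_of_deriv h2] with t h3 h4
    rw [h3, map_smul, h4, h0, smul_zero]
  have hg2 : ¬∀ᶠ t in 𝓝 t₀, deriv B t = 0 := fun h => by
    obtain ⟨ψ, hψ, h0, -⟩ := exists_functional_eq_zero (B t₀) 0
    exact hψ (hplanar ψ h0 (h.mono fun t ht => by rw [ht, map_zero]))
  obtain ⟨d₂, E, φ₂, ad₂, aE, hE, hφE, hd₂, hψE⟩ := aB.deriv.exists_eq_smul hg2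
  have hg3 : ¬∀ᶠ t in 𝓝 t₀, deriv E t = 0 := fun h => by
    obtain ⟨ψ, hψ, h0, h1⟩ := exists_functional_eq_zero (B t₀) (E t₀)
    refine hψ (hplanar ψ h0 ?_)
    filter_upwards [hE, aE.eventually_const_of_deriv h] with t h2 h3
    rw [h2, h3, map_smul, h1, smul_zero]
  obtain ⟨d₃, G, φ₃, ad₃, aG, hG, hφG, hd₃, hψG⟩ := aE.deriv.exists_eq_smul hg3
  -- Correct the functionals so that they become dual to `B t₀`, `E t₀`, `G t₀`.
  set χ₂ : E3 →L[ℝ] ℝ := φ₂ - φ₂ (B t₀) • φ₁ with hχ₂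
  set χ₃ : E3 →L[ℝ] ℝ := φ₃ - φ₃ (B t₀) • φ₁ - φ₃ (E t₀) • χ₂ with hχ₃
  have h1E : ∀ᶠ t in 𝓝 t₀, φ₁ (E t) = 0 := hψE φ₁ (hconst φ₁ 1 aB hφB)
  have h2E : ∀ᶠ t in 𝓝 t₀, χ₂ (E t) = 1 := by
    filter_upwards [hφE, h1E] with t h1 h2
    simp [hχ₂, h1, h2]
  have h1G : ∀ᶠ t in 𝓝 t₀, φ₁ (G t) = 0 := hψG φ₁ (hconst φ₁ 0 aE h1E)
  have h2G : ∀ᶠ t in 𝓝 t₀, χ₂ (G t) = 0 := hψG χ₂ (hconst χ₂ 1 aE h2E)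
  have h3G : ∀ᶠ t in 𝓝 t₀, χ₃ (G t) = 1 := by
    filter_upwards [hφG, h1G, h2G] with t h1 h2 h3
    simp [hχ₃, h1, h2, h3]
  have e11 := hφB.self_of_nhds
  have e12 := h1E.self_of_nhds
  have e13 := h1G.self_of_nhds
  have e22 := h2E.self_of_nhds
  have e23 := h2G.self_of_nhds
  have e33 := h3G.self_of_nhds
  have e21 : χ₂ (B t₀) = 0 := by simp [hχ₂, e11]
  have e31 : χ₃ (B t₀) = 0 := by simp [hχ₃, e11, e21]
  have e32 : χ₃ (E t₀) = 0 := by simp [hχ₃, e12, e22]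
  have hli : LinearIndependent ℝ ![B t₀, E t₀, G t₀] := by
    rw [Fintype.linearIndependent_iff]
    intro w hw
    simp only [Fin.sum_univ_three, Matrix.cons_val] at hw
    have w0 := congrArg φ₁ hw
    have w1 := congrArg χ₂ hw
    have w2 := congrArg χ₃ hw
    simp only [map_add, map_smul, e11, e12, e13, e21, e22, e23, e31, e32, e33, smul_eq_mul,
      mul_zero, mul_one, add_zero, zero_add, map_zero] at w0 w1 w2
    intro i
    fin_cases i <;> assumption
  let f : Module.Basis (Fin 3) ℝ E3 := basisOfLinearIndependentOfCardEqFinrank hli (by simp)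
  have f0 : f 0 = B t₀ := by simp [f]
  have f1 : f 1 = E t₀ := by simp [f]
  have f2 : f 2 = G t₀ := by simp [f]
  have hrepr : ∀ v, v = φ₁ v • f 0 + χ₂ v • f 1 + χ₃ v • f 2 := fun v => by
    have h := f.sum_repr v
    rw [Fin.sum_univ_three, f0, f1, f2] at h
    have w0 := congrArg φ₁ h
    have w1 := congrArg χ₂ h
    have w2 := congrArg χ₃ h
    simp only [map_add, map_smul, e11, e12, e13, e21, e22, e23, e31, e32, e33, smul_eq_mul,
      mul_zero, mul_one, add_zero, zero_add] at w0 w1 w2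
    rw [f0, f1, f2, ← w0, ← w1, ← w2, h]
  have hall : ∀ᶠ t in 𝓝[>] t₀, (AnalyticAt ℝ r t ∧ AnalyticAt ℝ B t ∧ AnalyticAt ℝ E t ∧
      AnalyticAt ℝ d₁ t ∧ AnalyticAt ℝ d₂ t) ∧ (deriv r t = d₁ t • B t ∧
      deriv B t = d₂ t • E t ∧ deriv E t = d₃ t • G t) ∧
      (φ₁ (B t) = 1 ∧ χ₂ (E t) = 1 ∧ χ₃ (G t) = 1) ∧ 0 < d₁ t ∧ 0 < d₂ t ∧ 0 < d₃ t := by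
    filter_upwards [hd₁, hd₂, hd₃, hr.eventually_analyticAt.filter_mono nhdsWithin_le_nhds,
      aB.eventually_analyticAt.filter_mono nhdsWithin_le_nhds,
      aE.eventually_analyticAt.filter_mono nhdsWithin_le_nhds,
      ad₁.eventually_analyticAt.filter_mono nhdsWithin_le_nhds,
      ad₂.eventually_analyticAt.filter_mono nhdsWithin_le_nhds,
      hB.filter_mono nhdsWithin_le_nhds, hE.filter_mono nhdsWithin_le_nhds,
      hG.filter_mono nhdsWithin_le_nhds, hφB.filter_mono nhdsWithin_le_nhds,
      h2E.filter_mono nhdsWithin_le_nhds, h3G.filter_mono nhdsWithin_le_nhds]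
      with t p1 p2 p3 p4 p5 p6 p7 p8 p9 p10 p11 p12 p13 p14
    exact ⟨⟨p4, p5, p6, p7, p8⟩, ⟨p9, p10, p11⟩, ⟨p12, p13, p14⟩, p1, p2, p3⟩
  obtain ⟨b', hb', hsub⟩ := mem_nhdsGT_iff_exists_Ioo_subset.1 hall
  have hb0 : t₀ < b' := hb'
  set b := (t₀ + b') / 2 with hb
  have hlt : t₀ < b := by linarith
  have hIoo : ∀ t ∈ Ioo t₀ b, t ∈ Ioo t₀ b' := fun t ht => ⟨ht.1, by linarith [ht.2]⟩
  have han : ∀ t ∈ Icc t₀ b, AnalyticAt ℝ r t ∧ AnalyticAt ℝ B t ∧ AnalyticAt ℝ E t := by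
    intro t ht
    rcases ht.1.eq_or_lt with rfl | h
    · exact ⟨hr, aB, aE⟩
    · obtain ⟨⟨h1, h2, h3, -⟩, -⟩ := hsub (show t ∈ Ioo t₀ b' from ⟨h, by linarith [ht.2]⟩)
      exact ⟨h1, h2, h3⟩
  have hcr : ∀ ψ : E3 →L[ℝ] ℝ, ContinuousOn (fun t => ψ (r t)) (Icc t₀ b) := fun ψ t ht =>
    (ψ.continuous.continuousAt.comp (han t ht).1.continuousAt).continuousWithinAt
  have hcB : ∀ ψ : E3 →L[ℝ] ℝ, ContinuousOn (fun t => ψ (B t)) (Icc t₀ b) := fun ψ t ht =>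
    (ψ.continuous.continuousAt.comp (han t ht).2.1.continuousAt).continuousWithinAt
  have hcE : ∀ ψ : E3 →L[ℝ] ℝ, ContinuousOn (fun t => ψ (E t)) (Icc t₀ b) := fun ψ t ht =>
    (ψ.continuous.continuousAt.comp (han t ht).2.2.continuousAt).continuousWithinAt
  refine ⟨f, ⟨fun t => φ₁ (r t), fun t => χ₂ (r t), fun t => χ₃ (r t), fun t => χ₂ (B t),
    fun t => χ₃ (B t), fun t => χ₃ (E t), d₁, d₂, d₃⟩, b, hlt, ?_⟩
  refine ⟨⟨hcr _, hcr _, hcr _, hcB _, hcB _, hcE _, fun t ht => ?_, fun t ht => ?_,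
    fun t ht => ?_, fun t ht => ?_, fun t ht => ?_, fun t ht => ?_, fun t ht => ?_,
    fun t ht => ?_, fun t ht => ?_⟩, fun t => hrepr (r t), fun t ht => ?_, fun t ht => ?_,
    fun t ht => ?_⟩ <;>
    obtain ⟨⟨ar, aB', aE', ad₁', ad₂'⟩, ⟨er, eB, eE⟩, ⟨c1, c2, c3⟩, p1, p2, p3⟩ :=
      hsub (hIoo t ht)
  · exact (hderiv φ₁ ar).congr_deriv (by simp [er, c1])
  · exact (hderiv χ₂ ar).congr_deriv (by rw [er, map_smul, smul_eq_mul, mul_comm])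
  · exact (hderiv χ₃ ar).congr_deriv (by rw [er, map_smul, smul_eq_mul, mul_comm])
  · exact (hderiv χ₂ aB').congr_deriv (by rw [eB, map_smul, smul_eq_mul, c2, mul_one])
  · exact (hderiv χ₃ aB').congr_deriv (by rw [eB, map_smul, smul_eq_mul, mul_comm])
  · exact (hderiv χ₃ aE').congr_deriv (by rw [eE, map_smul, smul_eq_mul, c3, mul_one])
  · exact p1
  · exact p2
  · exact p3
  · exact ad₁'.differentiableAt
  · exact ad₁'.deriv.differentiableAt
  · exact ad₂'.differentiableAt

/-- By the identity theorem, an analytic curve whose derivative lies in a fixed plane of vectors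
near one parameter is planar. -/
theorem coplanar_of_eventually_deriv {r : ℝ → E3} {I : Set ℝ} (hI : IsPreconnected I)
    (hr : AnalyticOnNhd ℝ r I) {t₀ : ℝ} (ht₀ : t₀ ∈ I) {ψ : E3 →L[ℝ] ℝ} (hψ : ψ ≠ 0)
    (h : ∀ᶠ t in 𝓝 t₀, ψ (deriv r t) = 0) : Coplanar ℝ (r '' I) := by
  have h1 : AnalyticOnNhd ℝ (fun t => ψ (r t)) I := fun t ht => (ψ.analyticAt _).comp (hr t ht)
  have h2 : ∀ᶠ t in 𝓝 t₀, deriv (fun t => ψ (r t)) t = 0 := by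
    filter_upwards [h, (hr t₀ ht₀).eventually_analyticAt] with t h3 h4
    rw [← h3]
    exact (ψ.hasFDerivAt.comp_hasDerivAt t h4.differentiableAt.hasDerivAt).deriv
  have h3 : EqOn (fun t => ψ (r t)) (fun _ => ψ (r t₀)) I :=
    h1.eqOn_of_preconnected_of_eventuallyEq analyticOnNhd_const hI ht₀
      ((h1 t₀ ht₀).eventually_const_of_deriv h2)
  have h4 : vectorSpan ℝ (r '' I) ≤ LinearMap.ker ψ.toLinearMap := by
    rw [vectorSpan_def, Submodule.span_le]
    rintro _ ⟨_, ⟨t, ht, rfl⟩, _, ⟨s, hs, rfl⟩, rfl⟩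
    have e1 := h3 ht
    have e2 := h3 hs
    simp only at e1 e2
    simp [e1, e2]
  have h5 : Module.finrank ℝ (LinearMap.ker ψ.toLinearMap) ≤ 2 := by
    have h6 := ψ.toLinearMap.finrank_range_add_finrank_ker
    have h7 : Module.finrank ℝ (LinearMap.range ψ.toLinearMap) ≠ 0 := by
      intro h8
      rw [Submodule.finrank_eq_zero, LinearMap.range_eq_bot] at h8
      exact hψ (ContinuousLinearMap.coe_injective h8)
    rw [finrank_euclideanSpace_fin] at h6
    omega
  rw [Coplanar, ← Module.finrank_eq_rank]
  exact_mod_cast (Submodule.finrank_mono h4).trans h5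

/-! ### Existence of quasi-cubic segments -/

theorem mainTheorem1 {K : Type*} [Field K] [Algebra K ℝ] (c : Fin 3 → RatFunc K)
    (hproper : RatCurve.IsProper c)
    (hdefined : ∀ t ∈ Icc (0 : ℝ) 1, RatCurve.DefinedAt c t)
    (hnonplanar : ¬ Coplanar ℝ (RatCurve.point c '' Icc (0 : ℝ) 1))
    (t₀ : ℝ) (ht₀ : t₀ ∈ Ico (0 : ℝ) 1) :
    ∃ t₁ : ℝ, t₀ < t₁ ∧ t₁ ≤ 1 ∧ IsQuasiCubic c t₀ t₁ := by
  have ht₀' : t₀ ∈ Icc (0 : ℝ) 1 := ⟨ht₀.1, ht₀.2.le⟩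
  have han : AnalyticOnNhd ℝ (RatCurve.point c) (Icc 0 1) := fun t ht =>
    RatCurve.analyticAt_point (hdefined t ht)
  obtain ⟨f, C, b, hb, H⟩ := (han t₀ ht₀').exists_represents fun ψ hψ h =>
    hnonplanar (coplanar_of_eventually_deriv isPreconnected_Icc han ht₀' hψ h)
  obtain ⟨S, hS, hSing⟩ := RatCurve.finite_multiple_points hproper
  -- Choose `t₁` so close to `t₀` that no multiple point lies in `(t₀, t₁]`.
  have hS' : (S \ {t₀})ᶜ ∈ 𝓝[>] t₀ := nhdsWithin_le_nhds <|
    (hS.subset sdiff_subset).isClosed.isOpen_compl.mem_nhds fun h => h.2 rfl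
  obtain ⟨m, hm, hmS⟩ := mem_nhdsGT_iff_exists_Ioo_subset.1 hS'
  have hmt : t₀ < m := hm
  have hmin : t₀ < min (min m b) 1 := lt_min (lt_min hmt hb) ht₀.2
  obtain ⟨t₁, h1, h2⟩ := exists_between hmin
  have hm1 : t₁ < m := h2.trans_le ((min_le_left _ _).trans (min_le_left _ _))
  have hb1 : t₁ < b := h2.trans_le ((min_le_left _ _).trans (min_le_right _ _))
  have h11 : t₁ < 1 := h2.trans_le (min_le_right _ _)
  refine ⟨t₁, h1, h11.le, H.isQuasiCubic h1 hb1
    (fun t ht => hdefined t ⟨ht₀.1.trans ht.1, ht.2.trans h11.le⟩) fun t ht => ?_⟩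
  refine hSing t (fun htS => ?_) (hdefined t ⟨ht₀.1.trans ht.1.le, ht.2.trans h11.le⟩)
  exact hmS ⟨ht.1, ht.2.trans_lt hm1⟩ ⟨htS, ht.1.ne'⟩

end
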